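/- Let $I\subseteq(0,\infty)$ be a nonempty open interval. A pair $(f,g)$ of continuous functions $I\to\mathbb R$ is a Chebyshev system on $I$ if $D_{f,g}(x,y):=f(x)g(y)-f(y)g(x)\neq0$ for all distinct $x,y\in I$. Let $(f,g)\in\mathcal C_3(I)$, i.e., $f,g:I\to\mathbb R$ are three times continuously differentiable, $(f,g)$ is a Chebyshev system on $I$, and $f'g-fg'$ does not vanish on $I$. Let $(T,\mathcal A,\mu)$ be a probability space, let $\varphi_1,\dots,\varphi_d:T\to[0,1]$ be $\mu$-measurable functions with $\varphi_1+\cdots+\varphi_d=1$, and put $m(x,t):=\varphi_1(t)x_1+\cdots+\varphi_d(t)x_d$ for $x\in I^d$, $t\in T$. With $\varphi_i^*:=\varphi_i-\int_T\varphi_i\,d\mu$, assume that $$\mu\big(\{t\in T\mid \varphi_1^*(t)=\cdots=\varphi_d^*(t)=0\}\big)<1$$ and that there exist $i,j,l\in\{1,\dots,d\}$ with $\int_T\varphi_i^*\varphi_j^*\varphi_l^*\,d\mu\neq0$. For a Chebyshev system $(h,k)$ on $I$ and $x\in I^d$, let $M_{h,k,m;\mu}(x)$ denote the unique $y\in I$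 with $\int_T D_{h,k}(m(x,t),y)\,d\mu(t)=0$. For $(p,q)\in\mathbb C^2$ with $p+q,\,pq\in\mathbb R$ (that is, $p,q\in\mathbb R$ or $p=\bar q$), define for $x>0$ $$(h_{p,q}(x),k_{p,q}(x)):=\begin{cases}(x^p,\,x^q)&\text{if }p,q\in\mathbb R,\ p\ne q,\\ (x^p\log x,\,x^p)&\text{if }p=q\in\mathbb R,\\ (x^a\sin(b\log x),\,x^a\cos(b\log x))&\text{if }p=\bar q=a+bi,\ a,b\in\mathbb R,\ b\neq0,\end{cases}$$ and, whenever $(h_{p,q},k_{p,q})$ is a Chebyshev system on $I$ (which always holds if $p,q\in\mathbb R$), let the generalized Gini mean be $G_{p,q,m;\mu}:=M_{h_{p,q},k_{p,q},m;\mu}$ on $I^d$. Then $M_{f,g,m;\mu}$ is homogeneous, i.e., $$M_{f,g,m;\mu}(\lambda x)=\lambda M_{f,g,m;\mu}(x)\quad\text{for all }\lambda\in I/I:=\{u/v\mid u,v\in I\}\text{ and all }x\in I^d\text{ with }\lambda x\in I^d,$$ if and only if there exists a pair $(p,q)\in\mathbb C^2$ with $p+q,\,pq\in\mathbb R$ such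 that $(h_{p,q},k_{p,q})$ is a Chebyshev system on $I$ (so that $G_{p,q,m;\mu}$ is defined) and $M_{f,g,m;\mu}(x)=G_{p,q,m;\mu}(x)$ for all $x\in I^d$. -/

import Mathlib

open MeasureTheory Set
open scoped Pointwise

noncomputable section

namespace IntegralMeans

/-- The determinant `D_{f,g}(x,y) = f(x) g(y) - f(y) g(x)`. -/
def chebDet (f g : ℝ → ℝ) (x y : ℝ) : ℝ :=
  Matrix.det !![f x, f y; g x, g y]

/-- Two-dimensional Chebyshev systems on `I`, i.e. the class `C₀(I)`.
Only the values of `f` and `g` on `I` matter. -/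
structure IsChebyshevSystem (I : Set ℝ) (f g : ℝ → ℝ) : Prop where
  continuousOn_fst : ContinuousOn f I
  continuousOn_snd : ContinuousOn g I
  det_ne_zero : ∀ x ∈ I, ∀ y ∈ I, x ≠ y → chebDet f g x y ≠ 0

/-- The class `Cₙ(I)`: Chebyshev systems of `n` times continuously differentiable functions whose
Wronski determinant does not vanish on `I` (the last requirement only if `n ≥ 1`).
It is used for open sets `I`, where `deriv` is the derivative of the restriction to `I`. -/
structure ClassC (n : ℕ) (I : Set ℝ) (f g : ℝ → ℝ) : Prop where
  chebyshev : IsChebyshevSystem I f g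
  contDiffOn_fst : ContDiffOn ℝ n f I
  contDiffOn_snd : ContDiffOn ℝ n g I
  wronskian_ne_zero : 1 ≤ n → ∀ x ∈ I, Matrix.det !![deriv f x, f x; deriv g x, g x] ≠ 0

/-- The generalized Bajraktarević mean `M_{f,g,m;μ}(x)`: the solution `y ∈ I` of
`∫ D_{f,g}(m(x,t), y) dμ(t) = 0`. For a Chebyshev system `(f,g)` on a nonempty open interval `I`,
a probability measure `μ` and a measurable family `m` of means on `I`, there is exactly one such
`y` for every `x ∈ I^d`. (The value is `0` where no solution exists.) -/
def bajMean {T : Type*} [MeasurableSpace T] {d : ℕ} (I : Set ℝ) (f g : ℝ → ℝ)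
    (m : (Fin d → ℝ) → T → ℝ) (μ : Measure T) (x : Fin d → ℝ) : ℝ :=
  open Classical in
  if h : ∃ y ∈ I, ∫ t, chebDet f g (m x t) y ∂μ = 0 then h.choose else 0

/-- First generating function of the Gini means. For `p`, `q` real or complex conjugate. -/
def giniFst (p q : ℂ) (x : ℝ) : ℝ :=
  open Classical in
  if p.im = 0 ∧ q.im = 0 then
    if p = q then x ^ p.re * Real.log x else x ^ p.re
  else x ^ p.re * Real.sin (p.im * Real.log x)

/-- Second generating function of the Gini means. For `p`, `q` real or complex conjugate. -/
def giniSnd (p q : ℂ) (x : ℝ) : ℝ :=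
  open Classical in
  if p.im = 0 ∧ q.im = 0 then x ^ q.re
  else x ^ p.re * Real.cos (p.im * Real.log x)

/-- The generalized Gini mean `G_{p,q,m;μ}` on `I`; it is defined when
`IsChebyshevSystem I (giniFst p q) (giniSnd p q)`. -/
def giniMean {T : Type*} [MeasurableSpace T] {d : ℕ} (I : Set ℝ) (p q : ℂ)
    (m : (Fin d → ℝ) → T → ℝ) (μ : Measure T) (x : Fin d → ℝ) : ℝ :=
  bajMean I (giniFst p q) (giniSnd p q) m μ x

/-- Homogeneity of a `d`-variable function on `I^d`: `M(c x) = c M(x)` for all `c ∈ I / I` and all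
`x` with coordinates in `I ∩ (1/c) I`. -/
def IsHomogeneousOn {d : ℕ} (I : Set ℝ) (M : (Fin d → ℝ) → ℝ) : Prop :=
  ∀ c ∈ I / I, ∀ x : Fin d → ℝ, (∀ i, x i ∈ I ∧ c * x i ∈ I) → M (c • x) = c * M x

/-- The family of weighted arithmetic means `m(x,t) = ∑ φᵢ(t) xᵢ`. -/
def weightedFamily {T : Type*} {d : ℕ} (φ : Fin d → T → ℝ) (x : Fin d → ℝ) (t : T) : ℝ :=
  ∑ i, φ i t * x i

/-- The centred function `φ* = φ - ∫ φ dμ`. -/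
def centred {T : Type*} [MeasurableSpace T] (μ : Measure T) (φ : T → ℝ) (t : T) : ℝ :=
  φ t - ∫ s, φ s ∂μ

end IntegralMeans

end

namespace IntegralMeans

/-! Near the diagonal, `chebDet f g u v` divided by W(v) = f'g - fg' equals (u-v) + Φ(v)(u-v)²/2 +
Θ(v)(u-v)³/6 up to o(|u-v|³), locally uniformly in v, where Φ and Θ are the values of `wronskiQuot`
for second and third derivatives (`chebDet_expansion`). Along a ray x₀ + s·a the family is x₀ + s(η
+ Z) with Z centred. Integrating the expansion based at the mean y(s) = x₀ + s(η + w) gives an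
asymptotic relation in w and the moments of Z (`tendsto_moments`). Homogeneity says that the same w,
multiplied by c, solves the relation based at c·x₀. Eliminating w between the two
(`tendsto_scaling`) yields Φ(x) = cΦ(cx) at order s² and, once this is known everywhere, Θ(x) =
c²Θ(cx) at order s³. The second and third moments of Z must be nonzero; the third-moment hypothesis
provides a direction a for which both are. Hence Φ = α/x and Θ = γ/x², which forces f and g to solve
one Euler equation (`exists_solvesEuler_of_scaling`). A Gini pair is a fundamental system of it, so
the two determinants are proportional and define the same mean. Conversely, a dilation multiplies a
Gini determinant by a constant, so it carries roots to roots (`isHomogeneousOn_giniMean`). -/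

/-! ### Sign of a Chebyshev determinant -/

lemma chebDet_eq (f g : ℝ → ℝ) (x y : ℝ) : chebDet f g x y = f x * g y - f y * g x := by
  simp [chebDet, Matrix.det_fin_two]

/-- The set of pairs x < y in I is convex, hence connected, and the determinant is continuous and
nonvanishing on it. -/
lemma IsChebyshevSystem.exists_sign {I : Set ℝ} {f g : ℝ → ℝ} (h : IsChebyshevSystem I f g)
    (hI : I.OrdConnected) :
    ∃ σ : ℝ, ∀ x ∈ I, ∀ y ∈ I, x < y → 0 < σ * chebDet f g x y := by
  set S : Set (ℝ × ℝ) := {p | p.1 ∈ I ∧ p.2 ∈ I ∧ p.1 < p.2} with hS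
  have hconv : Convex ℝ S := by
    rintro ⟨a, b⟩ ⟨ha, hb, hab⟩ ⟨a', b'⟩ ⟨ha', hb', hab'⟩ u v hu hv huv
    refine ⟨hI.convex ha ha' hu hv huv, hI.convex hb hb' hu hv huv, ?_⟩
    simp only [Prod.smul_mk, Prod.mk_add_mk, smul_eq_mul] at *
    rcases hu.eq_or_lt with rfl | hu
    · have : v = 1 := by linarith
      subst this; linarith
    · nlinarith [mul_lt_mul_of_pos_left hab hu, mul_le_mul_of_nonneg_left hab'.le hv]
  have hcont : ContinuousOn (fun p : ℝ × ℝ => chebDet f g p.1 p.2) S := by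
    simp only [chebDet_eq]
    have h1 : MapsTo Prod.fst S I := fun p hp => hp.1
    have h2 : MapsTo Prod.snd S I := fun p hp => hp.2.1
    exact ((h.continuousOn_fst.comp _root_.continuousOn_fst h1).mul
      (h.continuousOn_snd.comp _root_.continuousOn_snd h2)).sub
      ((h.continuousOn_fst.comp _root_.continuousOn_snd h2).mul
      (h.continuousOn_snd.comp _root_.continuousOn_fst h1))
  have hne : ∀ p ∈ S, chebDet f g p.1 p.2 ≠ 0 := fun p hp =>
    h.det_ne_zero _ hp.1 _ hp.2.1 hp.2.2.ne
  by_cases hpos : ∃ p ∈ S, 0 < chebDet f g p.1 p.2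
  · obtain ⟨p, hp, hp0⟩ := hpos
    refine ⟨1, fun x hx y hy hxy => ?_⟩
    rw [one_mul]
    by_contra hcon
    obtain ⟨q, hq, hq0⟩ := hconv.isPreconnected.intermediate_value
      (show (x, y) ∈ S from ⟨hx, hy, hxy⟩) hp hcont
      (show (0 : ℝ) ∈ Icc _ _ from ⟨not_lt.1 hcon, hp0.le⟩)
    exact hne q hq hq0
  · push Not at hpos
    refine ⟨-1, fun x hx y hy hxy => ?_⟩
    have h1 := hpos (x, y) ⟨hx, hy, hxy⟩
    have h2 := hne (x, y) ⟨hx, hy, hxy⟩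
    have h3 : chebDet f g x y < 0 := lt_of_le_of_ne h1 h2
    linarith

/-! ### Existence and uniqueness of the root defining the mean -/

section Root

variable {T : Type*} [MeasurableSpace T] {μ : Measure T}

lemma aemeasurable_comp_of_continuousOn {m : T → ℝ} {f : ℝ → ℝ} {lo hi : ℝ}
    (hm : AEMeasurable m μ) (hmem : ∀ t, m t ∈ Icc lo hi) (hf : ContinuousOn f (Icc lo hi)) :
    AEMeasurable (fun t => f (m t)) μ := by
  have hle : lo ≤ hi ∨ IsEmpty T := by
    rcases isEmpty_or_nonempty T with h | ⟨⟨t⟩⟩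
    · exact Or.inr h
    · exact Or.inl ((hmem t).1.trans (hmem t).2)
  rcases hle with hle | hT
  -- Extending f by constants outside the compact interval gives a globally continuous, hence
  -- measurable, function.
  · have hc : Continuous (IccExtend hle ((Icc lo hi).domRestrict f)) :=
      (continuousOn_iff_continuous_domRestrict.1 hf).Icc_extend'
    refine (hc.measurable.comp_aemeasurable hm).congr (Filter.Eventually.of_forall fun t => ?_)
    exact IccExtend_of_mem hle _ (hmem t)
  · have : μ = 0 := Measure.eq_zero_of_isEmpty μ
    subst this
    exact aemeasurable_zero_measure

lemma integrable_comp_of_continuousOn [IsFiniteMeasure μ] {m : T → ℝ} {f : ℝ → ℝ} {lo hi : ℝ}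
    (hm : AEMeasurable m μ) (hmem : ∀ t, m t ∈ Icc lo hi) (hf : ContinuousOn f (Icc lo hi)) :
    Integrable (fun t => f (m t)) μ := by
  obtain ⟨C, hC⟩ := isCompact_Icc.exists_bound_of_continuousOn hf
  exact Integrable.of_bound (aemeasurable_comp_of_continuousOn hm hmem hf).aestronglyMeasurable C
    (Filter.Eventually.of_forall fun t => hC _ (hmem t))

variable [IsProbabilityMeasure μ] {I : Set ℝ} {f g : ℝ → ℝ} {m : T → ℝ} {lo hi : ℝ}

lemma IsChebyshevSystem.integral_chebDet (h : IsChebyshevSystem I f g) (hI : I.OrdConnected)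
    (hlo : lo ∈ I) (hhi : hi ∈ I) (hm : AEMeasurable m μ) (hmem : ∀ t, m t ∈ Icc lo hi) (y : ℝ) :
    ∫ t, chebDet f g (m t) y ∂μ = (∫ t, f (m t) ∂μ) * g y - f y * ∫ t, g (m t) ∂μ := by
  have hsub := hI.out hlo hhi
  simp only [chebDet_eq]
  rw [integral_sub, integral_mul_const, integral_const_mul]
  · exact (integrable_comp_of_continuousOn hm hmem (h.continuousOn_fst.mono hsub)).mul_const _
  · exact (integrable_comp_of_continuousOn hm hmem (h.continuousOn_snd.mono hsub)).const_mul _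

/-- After normalizing the sign, the integrand is nonpositive at `lo` and nonnegative at `hi`, so the
intermediate value theorem applies. -/
lemma IsChebyshevSystem.exists_root (h : IsChebyshevSystem I f g) (hI : I.OrdConnected)
    (hlo : lo ∈ I) (hhi : hi ∈ I) (hle : lo ≤ hi)
    (hm : AEMeasurable m μ) (hmem : ∀ t, m t ∈ Icc lo hi) :
    ∃ y ∈ Icc lo hi, ∫ t, chebDet f g (m t) y ∂μ = 0 := by
  obtain ⟨σ, hσ⟩ := h.exists_sign hI
  have hsub := hI.out hlo hhi
  have hself : ∀ x, chebDet f g x x = 0 := fun x => by rw [chebDet_eq]; ring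
  have hswap : ∀ x y, chebDet f g x y = -chebDet f g y x := fun x y => by
    rw [chebDet_eq, chebDet_eq]; ring
  have hcont : ContinuousOn (fun y => σ * ∫ t, chebDet f g (m t) y ∂μ) (Icc lo hi) := by
    simp only [h.integral_chebDet hI hlo hhi hm hmem]
    exact continuousOn_const.mul ((continuousOn_const.mul (h.continuousOn_snd.mono hsub)).sub
      ((h.continuousOn_fst.mono hsub).mul continuousOn_const))
  have h1 : σ * ∫ t, chebDet f g (m t) lo ∂μ ≤ 0 := by
    rw [← integral_const_mul]
    refine integral_nonpos fun t => ?_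
    rcases (hmem t).1.eq_or_lt with h0 | h0
    · simp [← h0, hself]
    · have := hσ _ hlo _ (hsub (hmem t)) h0
      simp only [Pi.zero_apply]
      rw [hswap]; linarith
  have h2 : 0 ≤ σ * ∫ t, chebDet f g (m t) hi ∂μ := by
    rw [← integral_const_mul]
    refine integral_nonneg fun t => ?_
    rcases (hmem t).2.eq_or_lt with h0 | h0
    · simp [h0, hself]
    · exact (hσ _ (hsub (hmem t)) _ hhi h0).le
  obtain ⟨y, hy, hy0⟩ := intermediate_value_Icc hle hcont ⟨h1, h2⟩
  refine ⟨y, hy, ?_⟩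
  -- The factor `σ` can vanish only if `lo = hi`, and then the integrand is identically zero.
  rcases mul_eq_zero.1 hy0 with h0 | h0
  · rcases hle.eq_or_lt with h' | h'
    · have : ∀ t, m t = y := fun t => by
        have := hmem t
        rw [← h', Icc_self] at this hy
        rw [mem_singleton_iff.1 this, mem_singleton_iff.1 hy]
      simp [this, hself]
    · have := hσ _ hlo _ hhi h'
      simp [h0] at this
  · exact h0

/-- Two distinct roots give a nonsingular homogeneous linear system for the integrals of f and g
along `m`, so both vanish. Then the determinant against every point integrates to zero; a point of
the open set I just below `lo` contradicts this, since there the determinant has constant sign. -/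
lemma IsChebyshevSystem.root_unique (h : IsChebyshevSystem I f g) (hI : I.OrdConnected)
    (hopen : IsOpen I) (hlo : lo ∈ I) (hhi : hi ∈ I)
    (hm : AEMeasurable m μ) (hmem : ∀ t, m t ∈ Icc lo hi) {y z : ℝ} (hy : y ∈ I) (hz : z ∈ I)
    (hy0 : ∫ t, chebDet f g (m t) y ∂μ = 0) (hz0 : ∫ t, chebDet f g (m t) z ∂μ = 0) : y = z := by
  by_contra hne
  have hD := h.det_ne_zero y hy z hz hne
  have hsub := hI.out hlo hhi
  rw [h.integral_chebDet hI hlo hhi hm hmem] at hy0 hz0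
  rw [chebDet_eq] at hD
  have hF : ∫ t, f (m t) ∂μ = 0 := by
    apply (mul_eq_zero.1 (_ : (∫ t, f (m t) ∂μ) * (f y * g z - f z * g y) = 0)).resolve_right hD
    linear_combination f y * hz0 - f z * hy0
  have hG : ∫ t, g (m t) ∂μ = 0 := by
    apply (mul_eq_zero.1 (_ : (∫ t, g (m t) ∂μ) * (f y * g z - f z * g y) = 0)).resolve_right hD
    linear_combination g y * hz0 - g z * hy0
  obtain ⟨ε, hε, hball⟩ := Metric.isOpen_iff.1 hopen lo hlo
  have hw : lo - ε / 2 ∈ I := hball (by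
    rw [Metric.mem_ball, Real.dist_eq, abs_lt]; constructor <;> linarith)
  set w := lo - ε / 2
  have hwlo : w < lo := by simp only [w]; linarith
  obtain ⟨σ, hσ⟩ := h.exists_sign hI
  have hint0 : ∫ t, σ * chebDet f g w (m t) ∂μ = 0 := by
    have h0 : ∫ t, chebDet f g (m t) w ∂μ = 0 := by
      rw [h.integral_chebDet hI hlo hhi hm hmem, hF, hG]; ring
    have : ∀ t, σ * chebDet f g w (m t) = (-σ) * chebDet f g (m t) w := fun t => by
      rw [chebDet_eq, chebDet_eq]; ring
    simp only [this]
    rw [integral_const_mul, h0, mul_zero]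
  have hpos : ∀ t, 0 < σ * chebDet f g w (m t) := fun t =>
    hσ _ hw _ (hsub (hmem t)) (hwlo.trans_le (hmem t).1)
  have hint : Integrable (fun t => σ * chebDet f g w (m t)) μ := by
    simp only [chebDet_eq]
    exact (((integrable_comp_of_continuousOn hm hmem (h.continuousOn_snd.mono hsub)).const_mul
      _).sub ((integrable_comp_of_continuousOn hm hmem
        (h.continuousOn_fst.mono hsub)).mul_const _)).const_mul _
  have := (integral_eq_zero_iff_of_nonneg (fun t => (hpos t).le) hint).1 hint0
  obtain ⟨t, ht⟩ := this.exists
  exact (hpos t).ne' ht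

end Root

/-! ### Means of weighted families and homogeneity of Gini means -/

section Mean

variable {T : Type*} [MeasurableSpace T] {μ : Measure T} {d : ℕ} {φ : Fin d → T → ℝ}

lemma aemeasurable_weightedFamily (hφmeas : ∀ i, AEMeasurable (φ i) μ) (x : Fin d → ℝ) :
    AEMeasurable (weightedFamily φ x) μ := by
  unfold weightedFamily
  exact Finset.aemeasurable_fun_sum _ fun i _ => (hφmeas i).mul_const _

lemma weightedFamily_mem_Icc {T : Type*} {d : ℕ} {φ : Fin d → T → ℝ}
    (hφ01 : ∀ i t, φ i t ∈ Icc (0 : ℝ) 1) (hφsum : ∀ t, ∑ i, φ i t = 1)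
    {x : Fin d → ℝ} {lo hi : ℝ} (hx : ∀ i, x i ∈ Icc lo hi) (t : T) :
    weightedFamily φ x t ∈ Icc lo hi := by
  unfold weightedFamily
  constructor
  · calc lo = ∑ i, φ i t * lo := by rw [← Finset.sum_mul, hφsum, one_mul]
      _ ≤ _ := Finset.sum_le_sum fun i _ => mul_le_mul_of_nonneg_left (hx i).1 (hφ01 i t).1
  · calc _ ≤ ∑ i, φ i t * hi :=
          Finset.sum_le_sum fun i _ => mul_le_mul_of_nonneg_left (hx i).2 (hφ01 i t).1
      _ = hi := by rw [← Finset.sum_mul, hφsum, one_mul]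

lemma exists_bounds (μ : Measure T) [IsProbabilityMeasure μ]
    (hφsum : ∀ t, ∑ i, φ i t = 1) (x : Fin d → ℝ) :
    ∃ i j, ∀ l, x l ∈ Icc (x i) (x j) := by
  obtain ⟨t⟩ : Nonempty T := nonempty_of_isProbabilityMeasure μ
  have : Nonempty (Fin d) := by
    by_contra hcon
    rw [not_nonempty_iff] at hcon
    simpa using hφsum t
  obtain ⟨i, hi⟩ := Finite.exists_min x
  obtain ⟨j, hj⟩ := Finite.exists_max x
  exact ⟨i, j, fun l => ⟨hi l, hj l⟩⟩

variable [IsProbabilityMeasure μ] {I : Set ℝ} {f g : ℝ → ℝ}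

lemma bajMean_spec (h : IsChebyshevSystem I f g) (hI : I.OrdConnected) (hopen : IsOpen I)
    (hφmeas : ∀ i, AEMeasurable (φ i) μ)
    (hφ01 : ∀ i t, φ i t ∈ Icc (0 : ℝ) 1) (hφsum : ∀ t, ∑ i, φ i t = 1)
    {x : Fin d → ℝ} {lo hi : ℝ} (hlo : lo ∈ I) (hhi : hi ∈ I) (hx : ∀ i, x i ∈ Icc lo hi) :
    bajMean I f g (weightedFamily φ) μ x ∈ Icc lo hi ∧
      ∫ t, chebDet f g (weightedFamily φ x t) (bajMean I f g (weightedFamily φ) μ x) ∂μ = 0 := by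
  have hm := aemeasurable_weightedFamily hφmeas x
  have hmem := weightedFamily_mem_Icc hφ01 hφsum hx
  obtain ⟨t⟩ : Nonempty T := nonempty_of_isProbabilityMeasure μ
  obtain ⟨y, hy, hy0⟩ := h.exists_root hI hlo hhi ((hmem t).1.trans (hmem t).2) hm hmem
  have hsub := hI.out hlo hhi
  have hex : ∃ y ∈ I, ∫ t, chebDet f g (weightedFamily φ x t) y ∂μ = 0 := ⟨y, hsub hy, hy0⟩
  have heq : bajMean I f g (weightedFamily φ) μ x = hex.choose := dif_pos hex
  obtain ⟨h1, h2⟩ := hex.choose_spec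
  rw [heq]
  have := h.root_unique hI hopen hlo hhi hm hmem h1 (hsub hy) h2 hy0
  exact ⟨this ▸ hy, h2⟩

lemma eq_bajMean_of_root (h : IsChebyshevSystem I f g) (hI : I.OrdConnected) (hopen : IsOpen I)
    (hφmeas : ∀ i, AEMeasurable (φ i) μ)
    (hφ01 : ∀ i t, φ i t ∈ Icc (0 : ℝ) 1) (hφsum : ∀ t, ∑ i, φ i t = 1)
    {x : Fin d → ℝ} (hx : ∀ i, x i ∈ I) {y : ℝ} (hy : y ∈ I)
    (hy0 : ∫ t, chebDet f g (weightedFamily φ x t) y ∂μ = 0) :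
    bajMean I f g (weightedFamily φ) μ x = y := by
  obtain ⟨i, j, hij⟩ := exists_bounds μ hφsum x
  obtain ⟨h1, h2⟩ := bajMean_spec h hI hopen hφmeas hφ01 hφsum (hx i) (hx j) hij
  exact h.root_unique hI hopen (hx i) (hx j) (aemeasurable_weightedFamily hφmeas x)
    (weightedFamily_mem_Icc hφ01 hφsum hij) (hI.out (hx i) (hx j) h1) hy h2 hy0

/-- A dilation acts on a Gini pair by a constant matrix: diagonal, triangular, or a multiple of a
rotation. Its determinant is the factor `ρ`. -/
lemma exists_chebDet_gini_mul (p q : ℂ) {c : ℝ} (hc : 0 < c) :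
    ∃ ρ : ℝ, ∀ u v : ℝ, 0 < u → 0 < v →
      chebDet (giniFst p q) (giniSnd p q) (c * u) (c * v) =
        ρ * chebDet (giniFst p q) (giniSnd p q) u v := by
  by_cases h : p.im = 0 ∧ q.im = 0
  · by_cases hpq : p = q
    · subst hpq
      refine ⟨c ^ p.re * c ^ p.re, fun u v hu hv => ?_⟩
      simp only [chebDet_eq, giniFst, giniSnd, h, and_self, if_true,
        Real.mul_rpow hc.le hu.le, Real.mul_rpow hc.le hv.le, Real.log_mul hc.ne' hu.ne',
        Real.log_mul hc.ne' hv.ne']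
      ring
    · refine ⟨c ^ p.re * c ^ q.re, fun u v hu hv => ?_⟩
      simp only [chebDet_eq, giniFst, giniSnd, h, and_self, if_true, if_neg hpq,
        Real.mul_rpow hc.le hu.le, Real.mul_rpow hc.le hv.le]
      ring
  · refine ⟨c ^ p.re * c ^ p.re, fun u v hu hv => ?_⟩
    simp only [chebDet_eq, giniFst, giniSnd, if_neg h,
        Real.mul_rpow hc.le hu.le, Real.mul_rpow hc.le hv.le, Real.log_mul hc.ne' hu.ne',
        Real.log_mul hc.ne' hv.ne', mul_add, Real.sin_add, Real.cos_add]
    linear_combination c ^ p.re * u ^ p.re * (c ^ p.re * v ^ p.re) *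
      (Real.sin (p.im * Real.log u) * Real.cos (p.im * Real.log v) -
        Real.sin (p.im * Real.log v) * Real.cos (p.im * Real.log u)) *
      Real.sin_sq_add_cos_sq (p.im * Real.log c)

lemma isHomogeneousOn_giniMean (p q : ℂ) (hI : I.OrdConnected) (hopen : IsOpen I)
    (hpos : I ⊆ Ioi 0) (h : IsChebyshevSystem I (giniFst p q) (giniSnd p q))
    (hφmeas : ∀ i, AEMeasurable (φ i) μ)
    (hφ01 : ∀ i t, φ i t ∈ Icc (0 : ℝ) 1) (hφsum : ∀ t, ∑ i, φ i t = 1) :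
    IsHomogeneousOn I (giniMean I p q (weightedFamily φ) μ) := by
  rintro c ⟨a, ha, b, hb, rfl⟩ x hx
  have hc : 0 < a / b := div_pos (hpos ha) (hpos hb)
  set c := a / b
  show bajMean I (giniFst p q) (giniSnd p q) (weightedFamily φ) μ (c • x) =
    c * bajMean I (giniFst p q) (giniSnd p q) (weightedFamily φ) μ x
  obtain ⟨i, j, hij⟩ := exists_bounds μ hφsum x
  obtain ⟨h1, h2⟩ := bajMean_spec h hI hopen hφmeas hφ01 hφsum (hx i).1 (hx j).1 hij
  have hsub := hI.out (hx i).1 (hx j).1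
  refine eq_bajMean_of_root (x := c • x) h hI hopen hφmeas hφ01 hφsum (fun i => (hx i).2) ?_ ?_
  · exact hI.out (hx i).2 (hx j).2 ⟨mul_le_mul_of_nonneg_left h1.1 hc.le,
      mul_le_mul_of_nonneg_left h1.2 hc.le⟩
  · obtain ⟨ρ, hρ⟩ := exists_chebDet_gini_mul p q hc
    have hmul : ∀ t, weightedFamily φ (c • x) t = c * weightedFamily φ x t := fun t => by
      simp only [weightedFamily, Pi.smul_apply, smul_eq_mul, Finset.mul_sum]
      exact Finset.sum_congr rfl fun i _ => by ring
    have : ∀ t, chebDet (giniFst p q) (giniSnd p q) (weightedFamily φ (c • x) t)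
        (c * bajMean I (giniFst p q) (giniSnd p q) (weightedFamily φ) μ x) =
        ρ * chebDet (giniFst p q) (giniSnd p q) (weightedFamily φ x t)
        (bajMean I (giniFst p q) (giniSnd p q) (weightedFamily φ) μ x) := fun t => by
      rw [hmul, hρ _ _ (hpos (hsub (weightedFamily_mem_Icc hφ01 hφsum hij t))) (hpos (hsub h1))]
    simp only [this]
    rw [integral_const_mul, h2, mul_zero]

end Mean

/-! ### Uniform Taylor expansion at the diagonal -/

open Filter Topology

/-- This is the mean value inequality on the segment from v to u. Iterated, it raises the order of a
Taylor remainder by one each time; the lost factor 1/(n+1) is harmless. -/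
lemma abs_le_mul_pow_succ_of_hasDerivAt {J : Set ℝ} (hJ : Convex ℝ J) {r r' : ℝ → ℝ} {v ε : ℝ}
    {n : ℕ} (hv : v ∈ J) (hr : ∀ u ∈ J, HasDerivAt r (r' u) u) (hv0 : r v = 0)
    (hε : 0 ≤ ε)
    (hb : ∀ u ∈ J, |r' u| ≤ ε * |u - v| ^ n) : ∀ u ∈ J, |r u| ≤ ε * |u - v| ^ (n + 1) := by
  intro u hu
  have hsub : uIcc v u ⊆ J := by
    rw [← segment_eq_uIcc]; exact hJ.segment_subset hv hu
  have := (convex_uIcc v u).norm_image_sub_le_of_norm_hasDerivWithin_le (f := r) (f' := r')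
    (C := ε * |u - v| ^ n) (x := v) (y := u) (fun z hz => (hr z (hsub hz)).hasDerivWithinAt)
    (fun z hz => by
      rw [Real.norm_eq_abs]
      refine (hb z (hsub hz)).trans ?_
      gcongr ε * ?_ ^ n
      exact abs_sub_left_of_mem_uIcc hz) left_mem_uIcc right_mem_uIcc
  rw [hv0, sub_zero, Real.norm_eq_abs, Real.norm_eq_abs] at this
  rw [pow_succ, ← mul_assoc]; exact this

/-- `f₁, f₂, f₃` are the successive derivatives of `f` on `I`, and `f₃` is continuous. -/
structure DerivChain (I : Set ℝ) (f f₁ f₂ f₃ : ℝ → ℝ) : Prop where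
  hasDerivAt_zero : ∀ x ∈ I, HasDerivAt f (f₁ x) x
  hasDerivAt_one : ∀ x ∈ I, HasDerivAt f₁ (f₂ x) x
  hasDerivAt_two : ∀ x ∈ I, HasDerivAt f₂ (f₃ x) x
  continuousOn_three : ContinuousOn f₃ I

lemma ContDiffOn.derivChain {I : Set ℝ} (hopen : IsOpen I) {f : ℝ → ℝ}
    (hf : ContDiffOn ℝ (3 : ℕ) f I) :
    DerivChain I f (deriv f) (deriv (deriv f)) (deriv (deriv (deriv f))) := by
  have h1 : ContDiffOn ℝ 2 (deriv f) I :=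
    ((contDiffOn_succ_iff_deriv_of_isOpen (n := 2) hopen).1 (by exact_mod_cast hf)).2.2
  have h2 : ContDiffOn ℝ 1 (deriv (deriv f)) I :=
    ((contDiffOn_succ_iff_deriv_of_isOpen (n := 1) hopen).1 (by exact_mod_cast h1)).2.2
  have h3 : ContDiffOn ℝ 0 (deriv (deriv (deriv f))) I :=
    ((contDiffOn_succ_iff_deriv_of_isOpen (n := 0) hopen).1 (by exact_mod_cast h2)).2.2
  have key : ∀ {h : ℝ → ℝ} {n : ℕ}, n ≠ 0 → ContDiffOn ℝ n h I →
      ∀ x ∈ I, HasDerivAt h (deriv h x) x := fun hn hh x hx =>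
    ((hh.differentiableOn (by exact_mod_cast hn)).differentiableAt
      (hopen.mem_nhds hx)).hasDerivAt
  exact ⟨key (n := 3) (by simp) hf, key (n := 2) (by simp) (by exact_mod_cast h1),
    key (n := 1) (by simp) (by exact_mod_cast h2), h3.continuousOn⟩

/-- The quotient `(fₙ g - f gₙ) / (f₁ g - f g₁)` of generalized Wronskians. -/
noncomputable def wronskiQuot (f f₁ fₙ g g₁ gₙ : ℝ → ℝ) (v : ℝ) : ℝ :=
  (fₙ v * g v - f v * gₙ v) / (f₁ v * g v - f v * g₁ v)

/-- Locally uniform third order Taylor formula. -/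
lemma taylor_three_uniform {I : Set ℝ} (hopen : IsOpen I) {f f₁ f₂ f₃ : ℝ → ℝ}
    (hf : DerivChain I f f₁ f₂ f₃) {x₀ : ℝ} (hx₀ : x₀ ∈ I)
    {ε : ℝ} (hε : 0 < ε) :
    ∃ δ > 0, ∀ u ∈ Metric.ball x₀ δ, ∀ v ∈ Metric.ball x₀ δ,
      |f u - (f v + f₁ v * (u - v) + f₂ v * (u - v) ^ 2 / 2 + f₃ v * (u - v) ^ 3 / 6)|
        ≤ ε * |u - v| ^ 3 := by
  obtain ⟨h1, h2, h3, h4⟩ := hf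
  have hc : ContinuousAt f₃ x₀ := h4.continuousAt (hopen.mem_nhds hx₀)
  obtain ⟨δ₁, hδ₁, hb₁⟩ := Metric.isOpen_iff.1 hopen x₀ hx₀
  obtain ⟨δ₂, hδ₂, hb₂⟩ := Metric.continuousAt_iff.1 hc (ε / 2) (by positivity)
  refine ⟨min δ₁ δ₂, lt_min hδ₁ hδ₂, fun u hu v hv => ?_⟩
  set J := Metric.ball x₀ (min δ₁ δ₂)
  have hJ : Convex ℝ J := convex_ball _ _
  have hJI : J ⊆ I := (Metric.ball_subset_ball (min_le_left _ _)).trans hb₁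
  have hid : ∀ z : ℝ, HasDerivAt (fun z => z - v) 1 z := fun z => (hasDerivAt_id z).sub_const v
  -- The oscillation of `f₃` on the ball is below ε; three integrations carry this bound to f.
  have e0 : ∀ z ∈ J, |f₃ z - f₃ v| ≤ ε * |z - v| ^ 0 := fun z hz => by
    have i1 := hb₂ ((Metric.mem_ball.1 hz).trans_le (min_le_right _ _))
    have i2 := hb₂ ((Metric.mem_ball.1 hv).trans_le (min_le_right _ _))
    rw [pow_zero, mul_one, ← Real.dist_eq]
    linarith [dist_triangle_right (f₃ z) (f₃ v) (f₃ x₀)]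
  have e1 := abs_le_mul_pow_succ_of_hasDerivAt (r := fun z => f₂ z - f₂ v - f₃ v * (z - v)) hJ hv
    (fun z hz => (((h3 z (hJI hz)).sub_const (f₂ v)).sub
      ((hid z).const_mul (f₃ v))).congr_deriv (by ring)) (by ring) hε.le e0
  have e2 := abs_le_mul_pow_succ_of_hasDerivAt
    (r := fun z => f₁ z - f₁ v - f₂ v * (z - v) - f₃ v * (z - v) ^ 2 / 2) hJ hv
    (fun z hz => ((((h2 z (hJI hz)).sub_const (f₁ v)).sub
      ((hid z).const_mul (f₂ v))).sub
      ((((hid z).pow 2).const_mul (f₃ v)).div_const 2)).congr_deriv (by simp; ring)) (by ring)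
      hε.le e1
  have e3 := abs_le_mul_pow_succ_of_hasDerivAt
    (r := fun z => f z - f v - f₁ v * (z - v) - f₂ v * (z - v) ^ 2 / 2 - f₃ v * (z - v) ^ 3 / 6)
    hJ hv
    (fun z hz => (((((h1 z (hJI hz)).sub_const (f v)).sub
      ((hid z).const_mul (f₁ v))).sub
      ((((hid z).pow 2).const_mul (f₂ v)).div_const 2)).sub
      ((((hid z).pow 3).const_mul (f₃ v)).div_const 6)).congr_deriv (by simp; ring)) (by ring)
      hε.le e2
  convert e3 u hu using 2
  ring

/-- Locally uniform expansion of the normalized Chebyshev determinant at the diagonal. -/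
lemma chebDet_expansion {I : Set ℝ} (hopen : IsOpen I) {f f₁ f₂ f₃ g g₁ g₂ g₃ : ℝ → ℝ}
    (hf : DerivChain I f f₁ f₂ f₃) (hg : DerivChain I g g₁ g₂ g₃)
    (hW : ∀ x ∈ I, f₁ x * g x - f x * g₁ x ≠ 0) {x₀ : ℝ} (hx₀ : x₀ ∈ I)
    {ε : ℝ} (hε : 0 < ε) :
    ∃ δ > 0, ∀ u ∈ Metric.ball x₀ δ, ∀ v ∈ Metric.ball x₀ δ,
      |chebDet f g u v / (f₁ v * g v - f v * g₁ v) - ((u - v) +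
        wronskiQuot f f₁ f₂ g g₁ g₂ v / 2 * (u - v) ^ 2 +
        wronskiQuot f f₁ f₃ g g₁ g₃ v / 6 * (u - v) ^ 3)|
        ≤ ε * |u - v| ^ 3 := by
  have hcf := (hf.hasDerivAt_zero x₀ hx₀).continuousAt
  have hcg := (hg.hasDerivAt_zero x₀ hx₀).continuousAt
  have hcW : ContinuousAt (fun v => f₁ v * g v - f v * g₁ v) x₀ :=
    ((hf.hasDerivAt_one x₀ hx₀).continuousAt.mul hcg).sub (hcf.mul (hg.hasDerivAt_one x₀ hx₀).continuousAt)
  -- `q` is the factor by which Taylor errors of f and g are amplified after division by the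
  -- Wronskian. It is at most `q x₀ + 1` nearby, so errors of size ε / (q x₀ + 1) suffice.
  set q : ℝ → ℝ := fun v => (|g v| + |f v|) / |f₁ v * g v - f v * g₁ v| with hq
  have hcq : ContinuousAt q x₀ := (hcg.abs.add hcf.abs).div hcW.abs (by simpa using hW x₀ hx₀)
  have hC : 0 < q x₀ + 1 := by positivity
  obtain ⟨δ₁, hδ₁, hb₁⟩ := Metric.isOpen_iff.1 hopen x₀ hx₀
  obtain ⟨δ₂, hδ₂, hb₂⟩ := Metric.continuousAt_iff.1 hcq 1 one_pos
  obtain ⟨δ₃, hδ₃, hb₃⟩ := taylor_three_uniform hopen hf hx₀ (div_pos hε hC)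
  obtain ⟨δ₄, hδ₄, hb₄⟩ := taylor_three_uniform hopen hg hx₀ (div_pos hε hC)
  refine ⟨min (min δ₁ δ₂) (min δ₃ δ₄), lt_min (lt_min hδ₁ hδ₂) (lt_min hδ₃ hδ₄),
    fun u hu v hv => ?_⟩
  have mem : ∀ {z}, z ∈ Metric.ball x₀ (min (min δ₁ δ₂) (min δ₃ δ₄)) →
      z ∈ Metric.ball x₀ δ₁ ∧ z ∈ Metric.ball x₀ δ₂ ∧ z ∈ Metric.ball x₀ δ₃ ∧
        z ∈ Metric.ball x₀ δ₄ := by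
    intro z hz
    simp only [Metric.mem_ball, lt_min_iff] at hz ⊢
    tauto
  obtain ⟨-, -, hu3, hu4⟩ := mem hu
  obtain ⟨hv1, hv2, hv3, hv4⟩ := mem hv
  have hWv := hW v (hb₁ hv1)
  have hqv : q v ≤ q x₀ + 1 := by
    have := hb₂ hv2
    rw [Real.dist_eq] at this
    linarith [(abs_lt.1 this).2]
  have e1 := hb₃ u hu3 v hv3
  have e2 := hb₄ u hu4 v hv4
  set Rf := f u - (f v + f₁ v * (u - v) + f₂ v * (u - v) ^ 2 / 2 + f₃ v * (u - v) ^ 3 / 6)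
    with hRf
  set Rg := g u - (g v + g₁ v * (u - v) + g₂ v * (u - v) ^ 2 / 2 + g₃ v * (u - v) ^ 3 / 6)
    with hRg
  have hW0 : 0 < |f₁ v * g v - f v * g₁ v| := abs_pos.2 hWv
  have heq : chebDet f g u v / (f₁ v * g v - f v * g₁ v) - ((u - v) +
        wronskiQuot f f₁ f₂ g g₁ g₂ v / 2 * (u - v) ^ 2 +
        wronskiQuot f f₁ f₃ g g₁ g₃ v / 6 * (u - v) ^ 3) =
      (g v * Rf - f v * Rg) / (f₁ v * g v - f v * g₁ v) := by
    rw [chebDet_eq, hRf, hRg, wronskiQuot, wronskiQuot]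
    obtain ⟨W, hWe⟩ : ∃ W, W = f₁ v * g v - f v * g₁ v := ⟨_, rfl⟩
    rw [← hWe] at hWv ⊢
    field_simp
    rw [hWe]
    ring
  rw [heq, abs_div, div_le_iff₀ hW0]
  calc |g v * Rf - f v * Rg| ≤ |g v| * |Rf| + |f v| * |Rg| := by
        rw [← abs_mul, ← abs_mul]; exact abs_sub _ _
    _ ≤ |g v| * (ε / (q x₀ + 1) * |u - v| ^ 3) + |f v| * (ε / (q x₀ + 1) * |u - v| ^ 3) := by
        gcongr
    _ = q v * |f₁ v * g v - f v * g₁ v| * (ε / (q x₀ + 1) * |u - v| ^ 3) := by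
        rw [hq]; field_simp
    _ ≤ (q x₀ + 1) * |f₁ v * g v - f v * g₁ v| * (ε / (q x₀ + 1) * |u - v| ^ 3) := by
        gcongr
    _ = ε * |u - v| ^ 3 * |f₁ v * g v - f v * g₁ v| := by field_simp

/-! ### Elimination of the mean between two base points -/

/-- In c·`h₀` - `h₁` the terms linear in w cancel. The leading coefficient is then cσ(a₀ - c·a₁)/2;
if the Φ-terms cancel exactly for small s, the next one is cτ(b₀ - c²b₁)/6. Only boundedness of w is
assumed, not differentiability of the mean. -/
lemma tendsto_scaling {Φ₀ Φ₁ Θ₀ Θ₁ w : ℝ → ℝ} {a₀ a₁ b₀ b₁ c σ τ C : ℝ}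
    (hΦ₀ : Tendsto Φ₀ (𝓝[>] 0) (𝓝 a₀)) (hΦ₁ : Tendsto Φ₁ (𝓝[>] 0) (𝓝 a₁))
    (hΘ₀ : Tendsto Θ₀ (𝓝[>] 0) (𝓝 b₀)) (hΘ₁ : Tendsto Θ₁ (𝓝[>] 0) (𝓝 b₁))
    (hw : ∀ᶠ s in 𝓝[>] 0, |w s| ≤ C) (hσ : σ ≠ 0) (hτ : τ ≠ 0) (hc : c ≠ 0)
    (h₀ : Tendsto (fun s => (-(s * w s) + Φ₀ s / 2 * (s ^ 2 * (σ + w s ^ 2)) +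
      Θ₀ s / 6 * (s ^ 3 * (τ - 3 * σ * w s - w s ^ 3))) / s ^ 3) (𝓝[>] 0) (𝓝 0))
    (h₁ : Tendsto (fun s => (-(s * (c * w s)) + Φ₁ s / 2 * (s ^ 2 * (c ^ 2 * σ + (c * w s) ^ 2)) +
      Θ₁ s / 6 * (s ^ 3 * (c ^ 3 * τ - 3 * (c ^ 2 * σ) * (c * w s) - (c * w s) ^ 3))) / s ^ 3)
      (𝓝[>] 0) (𝓝 0)) :
    a₀ = c * a₁ ∧ ((∀ᶠ s in 𝓝[>] 0, Φ₀ s = c * Φ₁ s) → b₀ = c ^ 2 * b₁) := by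
  have hs : Tendsto (fun s : ℝ => s) (𝓝[>] 0) (𝓝 0) := 
    tendsto_nhdsWithin_of_tendsto_nhds tendsto_id
  have hpos : ∀ᶠ s : ℝ in 𝓝[>] 0, 0 < s := eventually_mem_nhdsWithin
  have bdd : ∀ {F : ℝ → ℝ} {a : ℝ} {G : ℝ → ℝ}, Continuous G → Tendsto F (𝓝[>] 0) (𝓝 a) →
      Tendsto (fun s => s * (F s * G (w s))) (𝓝[>] 0) (𝓝 0) := by
    intro F a G hG hF
    obtain ⟨B, hB⟩ := (isCompact_Icc (a := -C) (b := C)).exists_bound_of_continuousOn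
      hG.continuousOn
    have h0 : Tendsto (fun s => s * F s) (𝓝[>] 0) (𝓝 0) := by simpa using hs.mul hF
    refine (bdd_le_mul_tendsto_zero' (f := fun s => G (w s)) B ?_ h0).congr fun s => by ring
    filter_upwards [hw] with s hs
    exact hB _ (abs_le.1 hs)
  -- Dividing the relation `h₀` by s expresses w as s times bounded terms plus a vanishing error.
  have hw0 : Tendsto w (𝓝[>] 0) (𝓝 0) := by
    have t1 := bdd (G := fun w => (σ + w ^ 2) / 2) (by fun_prop) hΦ₀
    have t2 := bdd (G := fun w => (τ - 3 * σ * w - w ^ 3) / 6) (by fun_prop) hΘ₀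
    have := ((t1.add (hs.mul t2)).sub ((hs.pow 2).mul h₀))
    simp only [mul_zero, add_zero, sub_zero] at this
    refine this.congr' ?_
    filter_upwards [hpos] with s hs
    field_simp
    ring
  have hA : Tendsto (fun s => σ + w s ^ 2) (𝓝[>] 0) (𝓝 σ) := by
    simpa using tendsto_const_nhds.add (hw0.pow 2)
  have hB : Tendsto (fun s => τ - 3 * σ * w s - w s ^ 3) (𝓝[>] 0) (𝓝 τ) := by
    simpa using (tendsto_const_nhds.sub (hw0.const_mul (3 * σ))).sub (hw0.pow 3)
  have hdiff := (h₀.const_mul c).sub h₁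
  constructor
  · have t1 := (((hΦ₀.sub (hΦ₁.const_mul c)).mul hA).const_mul (c / 2)).add
      (hs.mul (((hΘ₀.sub (hΘ₁.const_mul (c ^ 2))).mul hB).const_mul (c / 6)))
    have t2 := hs.mul hdiff
    have := tendsto_nhds_unique (t2.congr' (by
      filter_upwards [hpos] with s hs
      field_simp
      ring)) t1
    simp only [mul_zero, zero_mul, add_zero, sub_zero] at this
    have : a₀ - c * a₁ = 0 := by
      have h2 := this.symm
      simpa [hc, hσ] using h2
    linarith
  · intro hΦ
    have t1 := (((hΘ₀.sub (hΘ₁.const_mul (c ^ 2))).mul hB).const_mul (c / 6))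
    have := tendsto_nhds_unique (hdiff.congr' (by
      filter_upwards [hpos, hΦ] with s hs hΦ
      rw [hΦ]
      field_simp
      ring)) t1
    simp only [mul_zero, sub_zero] at this
    have : b₀ - c ^ 2 * b₁ = 0 := by
      have h2 := this.symm
      simpa [hc, hτ] using h2
    linarith


/-! ### Euler equations and their Gini fundamental systems -/

/-- `h` solves the Euler equation `x² h'' = α x h' + β h` on `I`, with first derivative `h₁`. -/
def SolvesEuler (α β : ℝ) (I : Set ℝ) (h h₁ : ℝ → ℝ) : Prop :=
  ∀ x ∈ I, HasDerivAt h (h₁ x) x ∧ HasDerivAt h₁ (α / x * h₁ x + β / x ^ 2 * h x) x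

/-- The substitution u = log x turns the Euler equation into H'' = (1 + α)H' + βH. -/
lemma SolvesEuler.comp_log {α β : ℝ} {I : Set ℝ} (hpos : I ⊆ Ioi 0) {H H₁ h : ℝ → ℝ}
    (h0 : ∀ u, HasDerivAt H (H₁ u) u)
    (h1 : ∀ u, HasDerivAt H₁ ((1 + α) * H₁ u + β * H u) u)
    (hh : ∀ x, 0 < x → h x = H (Real.log x)) :
    SolvesEuler α β I h (fun x => H₁ (Real.log x) / x) := by
  intro x hx
  have hx0 : 0 < x := hpos hx
  have hlog := Real.hasDerivAt_log hx0.ne'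
  constructor
  · have := (h0 (Real.log x)).comp x hlog
    rw [← div_eq_mul_inv] at this
    refine this.congr_of_eventuallyEq ?_
    filter_upwards [lt_mem_nhds hx0] with z hz using hh z hz
  · have := ((h1 (Real.log x)).comp x hlog).div (hasDerivAt_id x) hx0.ne'
    refine this.congr_deriv ?_
    rw [hh x hx0]
    simp only [Function.comp, id]
    field_simp
    ring

/-- By Abel's identity every Wronskian of two solutions satisfies W' = (α/x)W, so a quotient of two
such has zero derivative. -/
lemma SolvesEuler.wronskian_ratio_const {α β : ℝ} {I : Set ℝ} (hI : I.OrdConnected)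
    (hopen : IsOpen I) {a a₁ b b₁ h h₁ k k₁ : ℝ → ℝ}
    (ha : SolvesEuler α β I a a₁) (hb : SolvesEuler α β I b b₁)
    (hh : SolvesEuler α β I h h₁) (hk : SolvesEuler α β I k k₁)
    (hW : ∀ x ∈ I, h₁ x * k x - h x * k₁ x ≠ 0) :
    ∃ c : ℝ, ∀ x ∈ I, a₁ x * b x - a x * b₁ x = c * (h₁ x * k x - h x * k₁ x) := by
  rcases I.eq_empty_or_nonempty with rfl | ⟨x₀, hx₀⟩
  · exact ⟨0, by simp⟩
  have key : ∀ {u u₁ v v₁ : ℝ → ℝ}, SolvesEuler α β I u u₁ → SolvesEuler α β I v v₁ →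
      ∀ x ∈ I, HasDerivAt (fun x => u₁ x * v x - u x * v₁ x)
        (α / x * (u₁ x * v x - u x * v₁ x)) x := by
    intro u u₁ v v₁ hu hv x hx
    refine (((hu x hx).2.mul (hv x hx).1).sub ((hu x hx).1.mul (hv x hx).2)).congr_deriv ?_
    ring
  have hd : ∀ x ∈ I, HasDerivAt (fun x => (a₁ x * b x - a x * b₁ x) /
      (h₁ x * k x - h x * k₁ x)) 0 x := by
    intro x hx
    refine ((key ha hb x hx).div (key hh hk x hx) (hW x hx)).congr_deriv ?_
    rw [div_eq_zero_iff]; left; ring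
  refine ⟨(a₁ x₀ * b x₀ - a x₀ * b₁ x₀) / (h₁ x₀ * k x₀ - h x₀ * k₁ x₀), fun x hx => ?_⟩
  have := hopen.is_const_of_deriv_eq_zero hI.convex.isPreconnected
    (fun x hx => (hd x hx).differentiableAt.differentiableWithinAt)
    (fun x hx => (hd x hx).deriv) hx hx₀
  rw [← this, div_mul_cancel₀ _ (hW x hx)]

/-- Two solutions of an Euler equation expressed through a fundamental system. -/
lemma SolvesEuler.chebDet_eq_const_mul {α β : ℝ} {I : Set ℝ} (hI : I.OrdConnected)
    (hopen : IsOpen I) {f f₁ g g₁ h h₁ k k₁ : ℝ → ℝ}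
    (hf : SolvesEuler α β I f f₁) (hg : SolvesEuler α β I g g₁)
    (hh : SolvesEuler α β I h h₁) (hk : SolvesEuler α β I k k₁)
    (hW : ∀ x ∈ I, h₁ x * k x - h x * k₁ x ≠ 0) :
    ∃ κ : ℝ, ∀ x ∈ I, ∀ y ∈ I, chebDet f g x y = κ * chebDet h k x y := by
  have lin : ∀ {a a₁ : ℝ → ℝ}, SolvesEuler α β I a a₁ →
      ∃ r s : ℝ, ∀ x ∈ I, a x = r * h x + s * k x := by
    intro a a₁ ha
    -- Cramer's rule: the coordinates of a in the basis h, k are constant Wronskian quotients.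
    obtain ⟨r, hr⟩ := SolvesEuler.wronskian_ratio_const hI hopen ha hk hh hk hW
    obtain ⟨s, hs⟩ := SolvesEuler.wronskian_ratio_const hI hopen hh ha hh hk hW
    refine ⟨r, s, fun x hx => mul_right_cancel₀ (hW x hx) ?_⟩
    linear_combination h x * hr x hx + k x * hs x hx
  obtain ⟨r, s, hrs⟩ := lin hf
  obtain ⟨r', s', hrs'⟩ := lin hg
  refine ⟨r * s' - s * r', fun x hx y hy => ?_⟩
  rw [chebDet_eq, chebDet_eq, hrs x hx, hrs y hy, hrs' x hx, hrs' y hy]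
  ring

/-- The Euler equation has a fundamental system of Gini type. -/
lemma exists_gini_solvesEuler (α β : ℝ) {I : Set ℝ} (hpos : I ⊆ Ioi 0) :
    ∃ p q : ℂ, (p + q).im = 0 ∧ (p * q).im = 0 ∧ ∃ h₁ k₁ : ℝ → ℝ,
      SolvesEuler α β I (giniFst p q) h₁ ∧ SolvesEuler α β I (giniSnd p q) k₁ ∧
      ∀ x ∈ I, h₁ x * giniSnd p q x - giniFst p q x * k₁ x ≠ 0 := by
  have hexp : ∀ r u : ℝ, HasDerivAt (fun u => Real.exp (u * r)) (r * Real.exp (u * r)) u :=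
    fun r u => by
      simpa [mul_comm] using ((hasDerivAt_id u).mul_const r).exp
  have hsolve : ∀ (p q : ℂ) (H H₁ K K₁ : ℝ → ℝ), (p + q).im = 0 → (p * q).im = 0 →
      (∀ x, 0 < x → giniFst p q x = H (Real.log x)) →
      (∀ x, 0 < x → giniSnd p q x = K (Real.log x)) →
      (∀ u, HasDerivAt H (H₁ u) u) → (∀ u, HasDerivAt H₁ ((1 + α) * H₁ u + β * H u) u) →
      (∀ u, HasDerivAt K (K₁ u) u) → (∀ u, HasDerivAt K₁ ((1 + α) * K₁ u + β * K u) u) →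
      (∀ u, H₁ u * K u - H u * K₁ u ≠ 0) →
      ∃ p q : ℂ, (p + q).im = 0 ∧ (p * q).im = 0 ∧ ∃ h₁ k₁ : ℝ → ℝ,
      SolvesEuler α β I (giniFst p q) h₁ ∧ SolvesEuler α β I (giniSnd p q) k₁ ∧
      ∀ x ∈ I, h₁ x * giniSnd p q x - giniFst p q x * k₁ x ≠ 0 := by
    intro p q H H₁ K K₁ hs hp hH hK h0 h1 k0 k1 hW
    refine ⟨p, q, hs, hp, _, _, SolvesEuler.comp_log hpos h0 h1 hH,
      SolvesEuler.comp_log hpos k0 k1 hK, fun x hx hcon => hW (Real.log x) ?_⟩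
    have hx0 : x ≠ 0 := (show 0 < x from hpos hx).ne'
    rw [hH x (hpos hx), hK x (hpos hx)] at hcon
    field_simp at hcon
    linear_combination hcon
  -- The sign of the discriminant of λ² = (1 + α)λ + β selects the conjugate, double or distinct
  -- real exponents.
  rcases lt_trichotomy ((1 + α) ^ 2 + 4 * β) 0 with hΔ | hΔ | hΔ
  · obtain ⟨b, hb0, hb⟩ : ∃ b : ℝ, 0 < b ∧ 4 * b ^ 2 = -((1 + α) ^ 2 + 4 * β) := by
      refine ⟨Real.sqrt (-((1 + α) ^ 2 + 4 * β) / 4), Real.sqrt_pos.2 (by linarith), ?_⟩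
      rw [Real.sq_sqrt (by linarith)]; ring
    set a : ℝ := (1 + α) / 2 with ha
    have hβ : β = -(a ^ 2 + b ^ 2) := by rw [ha]; linear_combination hb / 4
    have hα : 1 + α = 2 * a := by rw [ha]; ring
    have hbu : ∀ u : ℝ, HasDerivAt (fun u => b * u) b u := fun u => by
      simpa using (hasDerivAt_id u).const_mul b
    refine hsolve ⟨a, b⟩ ⟨a, -b⟩ (fun u => Real.exp (u * a) * Real.sin (b * u))
      (fun u => a * (Real.exp (u * a) * Real.sin (b * u)) + b * (Real.exp (u * a) *
        Real.cos (b * u)))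
      (fun u => Real.exp (u * a) * Real.cos (b * u))
      (fun u => a * (Real.exp (u * a) * Real.cos (b * u)) - b * (Real.exp (u * a) *
        Real.sin (b * u))) (by simp) (by simp; ring) ?_ ?_ ?_ ?_ ?_ ?_ ?_
    · intro x hx
      simp [giniFst, hb0.ne', Real.rpow_def_of_pos hx]
    · intro x hx
      simp [giniSnd, hb0.ne', Real.rpow_def_of_pos hx]
    · intro u
      refine ((hexp a u).mul (hbu u).sin).congr_deriv ?_
      ring
    · intro u
      refine ((((hexp a u).mul (hbu u).sin).const_mul a).add
        (((hexp a u).mul (hbu u).cos).const_mul b)).congr_deriv ?_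
      rw [hα, hβ]; ring
    · intro u
      refine ((hexp a u).mul (hbu u).cos).congr_deriv ?_
      ring
    · intro u
      refine ((((hexp a u).mul (hbu u).cos).const_mul a).sub
        (((hexp a u).mul (hbu u).sin).const_mul b)).congr_deriv ?_
      rw [hα, hβ]; ring
    · intro u
      have : (b * Real.exp (u * a) ^ 2 : ℝ) ≠ 0 :=
        mul_ne_zero hb0.ne' (pow_ne_zero _ (Real.exp_pos _).ne')
      convert this using 1
      linear_combination b * Real.exp (u * a) ^ 2 * Real.sin_sq_add_cos_sq (b * u)
  · set a : ℝ := (1 + α) / 2 with ha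
    have hβ : β = -a ^ 2 := by rw [ha]; linear_combination hΔ / 4
    have hα : 1 + α = 2 * a := by rw [ha]; ring
    refine hsolve (a : ℂ) (a : ℂ) (fun u => Real.exp (u * a) * u)
      (fun u => a * (Real.exp (u * a) * u) + Real.exp (u * a))
      (fun u => Real.exp (u * a)) (fun u => a * Real.exp (u * a))
      (by simp) (by simp) ?_ ?_ ?_ ?_ ?_ ?_ ?_
    · intro x hx
      simp [giniFst, Real.rpow_def_of_pos hx]
    · intro x hx
      simp [giniSnd, Real.rpow_def_of_pos hx]
    · intro u
      refine ((hexp a u).mul (hasDerivAt_id u)).congr_deriv ?_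
      simp only [id]; ring
    · intro u
      refine ((((hexp a u).mul (hasDerivAt_id u)).const_mul a).add (hexp a u)).congr_deriv ?_
      rw [hα, hβ]; simp only [id]; ring
    · exact hexp a
    · intro u
      refine ((hexp a u).const_mul a).congr_deriv ?_
      rw [hα, hβ]; ring
    · intro u
      have : (Real.exp (u * a) ^ 2 : ℝ) ≠ 0 := pow_ne_zero _ (Real.exp_pos _).ne'
      convert this using 1
      ring
  · obtain ⟨b, hb0, hb⟩ : ∃ b : ℝ, 0 < b ∧ b ^ 2 = (1 + α) ^ 2 + 4 * β :=
      ⟨Real.sqrt ((1 + α) ^ 2 + 4 * β), Real.sqrt_pos.2 hΔ, Real.sq_sqrt hΔ.le⟩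
    set p : ℝ := (1 + α + b) / 2 with hp
    set q : ℝ := (1 + α - b) / 2 with hq
    have hpq : p - q = b := by rw [hp, hq]; ring
    have hα : 1 + α = p + q := by rw [hp, hq]; ring
    have hβ : β = -(p * q) := by rw [hp, hq]; linear_combination -hb / 4
    have hne : (p : ℂ) ≠ (q : ℂ) := fun h => hb0.ne' (by
      rw [← hpq, Complex.ofReal_injective h, sub_self])
    refine hsolve (p : ℂ) (q : ℂ) (fun u => Real.exp (u * p)) (fun u => p * Real.exp (u * p))
      (fun u => Real.exp (u * q)) (fun u => q * Real.exp (u * q))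
      (by simp) (by simp) ?_ ?_ ?_ ?_ ?_ ?_ ?_
    · intro x hx
      have : p ≠ q := fun h => hne (by rw [h])
      simp [giniFst, Real.rpow_def_of_pos hx, this]
    · intro x hx
      simp [giniSnd, Real.rpow_def_of_pos hx]
    · exact hexp p
    · intro u
      refine ((hexp p u).const_mul p).congr_deriv ?_
      rw [hα, hβ]; ring
    · exact hexp q
    · intro u
      refine ((hexp q u).const_mul q).congr_deriv ?_
      rw [hα, hβ]; ring
    · intro u
      have : b * (Real.exp (u * p) * Real.exp (u * q)) ≠ 0 := by positivity
      convert this using 1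
      rw [← hpq]; ring

/-! ### Integrated expansion and moments -/

section Moments

variable {T : Type*} [MeasurableSpace T] {μ : Measure T} [IsProbabilityMeasure μ]

lemma integrable_pow_of_bound {Z : T → ℝ} {K : ℝ} (hZ : AEMeasurable Z μ) (hK : ∀ t, |Z t| ≤ K)
    (n : ℕ) : Integrable (fun t => Z t ^ n) μ :=
  Integrable.of_bound (hZ.pow_const n).aestronglyMeasurable (K ^ n)
    (Eventually.of_forall fun t => by
      rw [norm_pow, Real.norm_eq_abs]; exact pow_le_pow_left₀ (abs_nonneg _) (hK t) n)

lemma integral_cubic {Z : T → ℝ} {K : ℝ} (hZ : AEMeasurable Z μ) (hK : ∀ t, |Z t| ≤ K)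
    (hmean : ∫ t, Z t ∂μ = 0) (c₀ c₁ c₂ c₃ : ℝ) :
    Integrable (fun t => c₀ + c₁ * Z t + c₂ * Z t ^ 2 + c₃ * Z t ^ 3) μ ∧
    ∫ t, (c₀ + c₁ * Z t + c₂ * Z t ^ 2 + c₃ * Z t ^ 3) ∂μ =
      c₀ + c₂ * ∫ t, Z t ^ 2 ∂μ + c₃ * ∫ t, Z t ^ 3 ∂μ := by
  have i0 : Integrable (fun _ : T => c₀) μ := integrable_const _
  have i1 : Integrable (fun t => c₁ * Z t) μ := by
    simpa using (integrable_pow_of_bound hZ hK 1).const_mul c₁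
  have i2 := (integrable_pow_of_bound hZ hK 2).const_mul c₂
  have i3 := (integrable_pow_of_bound hZ hK 3).const_mul c₃
  have i01 : Integrable (fun t => c₀ + c₁ * Z t) μ := i0.add i1
  have i012 : Integrable (fun t => c₀ + c₁ * Z t + c₂ * Z t ^ 2) μ := i01.add i2
  refine ⟨i012.add i3, ?_⟩
  rw [integral_add i012 i3, integral_add i01 i2, integral_add i0 i1]
  simp [integral_const_mul, hmean]

/-- The expansion is based at y(s), which moves with s, so its uniformity in the base point is
essential. Since m - y = s(Z - w) and Z has mean zero, only σ and τ survive integration. -/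
lemma tendsto_moments {I : Set ℝ} (hopen : IsOpen I) {f f₁ f₂ f₃ g g₁ g₂ g₃ : ℝ → ℝ}
    (hf : DerivChain I f f₁ f₂ f₃) (hg : DerivChain I g g₁ g₂ g₃)
    (hW : ∀ x ∈ I, f₁ x * g x - f x * g₁ x ≠ 0) {x₀ : ℝ} (hx₀ : x₀ ∈ I)
    {Z : T → ℝ} {K η : ℝ} (hZ : AEMeasurable Z μ) (hK : ∀ t, |η + Z t| ≤ K)
    (hmean : ∫ t, Z t ∂μ = 0) {σ τ : ℝ} (hσ : ∫ t, Z t ^ 2 ∂μ = σ) (hτ : ∫ t, Z t ^ 3 ∂μ = τ)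
    {y w : ℝ → ℝ} (hw : ∀ s, w s = (y s - x₀) / s - η)
    (hy : ∀ᶠ s in 𝓝[>] 0, |y s - x₀| ≤ K * s ∧
      ∫ t, chebDet f g (x₀ + s * (η + Z t)) (y s) ∂μ = 0) :
    Tendsto (fun s => (-(s * w s) +
      wronskiQuot f f₁ f₂ g g₁ g₂ (y s) / 2 * (s ^ 2 * (σ + w s ^ 2)) +
      wronskiQuot f f₁ f₃ g g₁ g₃ (y s) / 6 * (s ^ 3 * (τ - 3 * σ * w s - w s ^ 3))) / s ^ 3)
      (𝓝[>] 0) (𝓝 0) := by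
  obtain ⟨t₀⟩ : Nonempty T := nonempty_of_isProbabilityMeasure μ
  have hK0 : 0 ≤ K := (abs_nonneg _).trans (hK t₀)
  have hZb : ∀ t, |Z t| ≤ K + |η| := fun t => by
    have := abs_sub (η + Z t) η
    rw [add_sub_cancel_left] at this
    linarith [hK t]
  rw [Metric.tendsto_nhds]
  intro ε hε
  -- Both m and y lie within K·s of x₀, so |m - y|³ ≤ 8K³s³; this constant makes the total error
  -- less than εs³.
  have hε' : 0 < ε / (2 * (8 * K ^ 3 + 1)) := by positivity
  obtain ⟨δ, hδ, hexp⟩ := chebDet_expansion hopen hf hg hW hx₀ hε'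
  obtain ⟨δ', hδ', hball⟩ := Metric.isOpen_iff.1 hopen x₀ hx₀
  have hsmall : ∀ {r : ℝ}, 0 < r → ∀ᶠ s : ℝ in 𝓝[>] 0, K * s < r := fun {r} hr => by
    have : Tendsto (fun s : ℝ => K * s) (𝓝[>] 0) (𝓝 0) := by
      simpa using (tendsto_nhdsWithin_of_tendsto_nhds (s := Ioi (0 : ℝ)) (a := (0 : ℝ))
        tendsto_id).const_mul K
    exact this.eventually (gt_mem_nhds hr)
  filter_upwards [hy, hsmall hδ, hsmall hδ', eventually_mem_nhdsWithin] with s hys hs hs' hs0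
  obtain ⟨hys, hroot⟩ := hys
  have hs0 : 0 < s := hs0
  set W := f₁ (y s) * g (y s) - f (y s) * g₁ (y s) with hWdef
  set Φ := wronskiQuot f f₁ f₂ g g₁ g₂ (y s)
  set Θ := wronskiQuot f f₁ f₃ g g₁ g₃ (y s)
  have hws : y s = x₀ + s * (η + w s) := by rw [hw]; field_simp; ring
  have hyball : y s ∈ Metric.ball x₀ δ := by
    rw [Metric.mem_ball, Real.dist_eq]; exact hys.trans_lt hs
  have hmabs : ∀ t, |s * (η + Z t)| ≤ K * s := fun t => by
    rw [abs_mul, abs_of_pos hs0, mul_comm]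
    exact mul_le_mul_of_nonneg_right (hK t) hs0.le
  have hpt : ∀ t, ‖chebDet f g (x₀ + s * (η + Z t)) (y s) / W -
      ((x₀ + s * (η + Z t) - y s) + Φ / 2 * (x₀ + s * (η + Z t) - y s) ^ 2 +
        Θ / 6 * (x₀ + s * (η + Z t) - y s) ^ 3)‖ ≤
      ε / (2 * (8 * K ^ 3 + 1)) * (2 * (K * s)) ^ 3 := fun t => by
    refine (hexp _ ?_ _ hyball).trans ?_
    · rw [Metric.mem_ball, Real.dist_eq, add_sub_cancel_left]
      exact (hmabs t).trans_lt hs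
    · gcongr
      have : x₀ + s * (η + Z t) - y s = s * (η + Z t) - (y s - x₀) := by ring
      rw [this]
      linarith [abs_sub (s * (η + Z t)) (y s - x₀), hmabs t]
  have hcub : ∀ t, (x₀ + s * (η + Z t) - y s) + Φ / 2 * (x₀ + s * (η + Z t) - y s) ^ 2 +
        Θ / 6 * (x₀ + s * (η + Z t) - y s) ^ 3 =
      (-(s * w s) + Φ / 2 * s ^ 2 * w s ^ 2 - Θ / 6 * s ^ 3 * w s ^ 3) +
      (s - Φ * s ^ 2 * w s + Θ / 2 * s ^ 3 * w s ^ 2) * Z t +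
      (Φ / 2 * s ^ 2 - Θ / 2 * s ^ 3 * w s) * Z t ^ 2 + (Θ / 6 * s ^ 3) * Z t ^ 3 := fun t => by
    have : x₀ + s * (η + Z t) - y s = s * (Z t - w s) := by
      linear_combination -hws
    rw [this]
    ring
  obtain ⟨hint, hval⟩ := integral_cubic hZ hZb hmean
    (-(s * w s) + Φ / 2 * s ^ 2 * w s ^ 2 - Θ / 6 * s ^ 3 * w s ^ 3)
    (s - Φ * s ^ 2 * w s + Θ / 2 * s ^ 3 * w s ^ 2)
    (Φ / 2 * s ^ 2 - Θ / 2 * s ^ 3 * w s) (Θ / 6 * s ^ 3)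
  have hDint : Integrable (fun t => chebDet f g (x₀ + s * (η + Z t)) (y s) / W) μ := by
    have hsub : Icc (x₀ - K * s) (x₀ + K * s) ⊆ I := fun z hz => hball (by
      rw [Metric.mem_ball, Real.dist_eq, abs_lt]
      constructor <;> linarith [hz.1, hz.2])
    have hmem : ∀ t, x₀ + s * (η + Z t) ∈ Icc (x₀ - K * s) (x₀ + K * s) := fun t => by
      have := abs_le.1 (hmabs t)
      constructor <;> linarith
    have hm : AEMeasurable (fun t => x₀ + s * (η + Z t)) μ :=
      ((hZ.const_add η).const_mul s).const_add x₀
    have cf : ContinuousOn f I := fun x hx =>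
      (hf.hasDerivAt_zero x hx).continuousAt.continuousWithinAt
    have cg : ContinuousOn g I := fun x hx =>
      (hg.hasDerivAt_zero x hx).continuousAt.continuousWithinAt
    simp only [chebDet_eq]
    exact (((integrable_comp_of_continuousOn hm hmem (cf.mono hsub)).mul_const _).sub
      ((integrable_comp_of_continuousOn hm hmem (cg.mono hsub)).const_mul _)).div_const _
  have hbound := norm_integral_le_of_norm_le_const (μ := μ) (Eventually.of_forall hpt)
  simp only [hcub] at hbound
  rw [integral_sub hDint hint, integral_div, hroot, hval, zero_div, zero_sub, norm_neg, hσ, hτ,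
    probReal_univ, mul_one, Real.norm_eq_abs] at hbound
  rw [Real.dist_eq, sub_zero, abs_div, abs_of_pos (pow_pos hs0 3), div_lt_iff₀ (pow_pos hs0 3)]
  have e1 : -(s * w s) + Φ / 2 * (s ^ 2 * (σ + w s ^ 2)) +
      Θ / 6 * (s ^ 3 * (τ - 3 * σ * w s - w s ^ 3)) =
      -(s * w s) + Φ / 2 * s ^ 2 * w s ^ 2 - Θ / 6 * s ^ 3 * w s ^ 3 +
        (Φ / 2 * s ^ 2 - Θ / 2 * s ^ 3 * w s) * σ + Θ / 6 * s ^ 3 * τ := by ring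
  rw [e1]
  refine hbound.trans_lt ?_
  have e2 : ε / (2 * (8 * K ^ 3 + 1)) * (2 * (K * s)) ^ 3 =
      ε * s ^ 3 * (8 * K ^ 3 / (2 * (8 * K ^ 3 + 1))) := by field_simp; ring
  rw [e2]
  have h3 : 8 * K ^ 3 / (2 * (8 * K ^ 3 + 1)) < 1 := by
    rw [div_lt_one (by positivity)]
    have : 0 ≤ K ^ 3 := by positivity
    linarith
  exact mul_lt_of_lt_one_right (by positivity) h3

/-- By polarization a product of three variables is a combination of cubes of their sums, so if all
cubes integrated to zero, every mixed third moment would vanish. -/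
lemma exists_cubic_ne_zero {d : ℕ} {Z : Fin d → T → ℝ} {K : ℝ} (hZ : ∀ i, AEMeasurable (Z i) μ)
    (hK : ∀ i t, |Z i t| ≤ K) (h : ∃ i j l, ∫ t, Z i t * Z j t * Z l t ∂μ ≠ 0) :
    ∃ a : Fin d → ℝ, ∫ t, (∑ i, a i * Z i t) ^ 3 ∂μ ≠ 0 := by
  by_contra! hcon
  obtain ⟨i, j, l, hne⟩ := h
  have hmeas : ∀ a : Fin d → ℝ, AEMeasurable (fun t => ∑ i, a i * Z i t) μ := fun a =>
    Finset.aemeasurable_fun_sum _ fun i _ => (hZ i).const_mul _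
  have hint : ∀ a : Fin d → ℝ, Integrable (fun t => (∑ i, a i * Z i t) ^ 3) μ := fun a =>
    integrable_pow_of_bound (K := ∑ i, |a i| * K) (hmeas a) (fun t =>
      (Finset.abs_sum_le_sum_abs _ _).trans (Finset.sum_le_sum fun i _ => by
        rw [abs_mul]; exact mul_le_mul_of_nonneg_left (hK i t) (abs_nonneg _))) 3
  have hadd : ∀ (a b : Fin d → ℝ) (t : T), ∑ i, (a + b) i * Z i t =
      ∑ i, a i * Z i t + ∑ i, b i * Z i t := fun a b t => by
    simp [add_mul, Finset.sum_add_distrib]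
  have hsingle : ∀ (k : Fin d) (t : T), ∑ i, (Pi.single k (1 : ℝ) : Fin d → ℝ) i * Z i t = Z k t :=
    fun k t => by simp [Pi.single_apply]
  set e : Fin d → Fin d → ℝ := fun k => Pi.single k 1
  have hpol : ∀ t, Z i t * Z j t * Z l t =
      1 / 6 * ((∑ k, (e i + e j + e l) k * Z k t) ^ 3 - (∑ k, (e i + e j) k * Z k t) ^ 3 -
      (∑ k, (e i + e l) k * Z k t) ^ 3 - (∑ k, (e j + e l) k * Z k t) ^ 3 +
      (∑ k, e i k * Z k t) ^ 3 + (∑ k, e j k * Z k t) ^ 3 + (∑ k, e l k * Z k t) ^ 3) := fun t => by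
    simp only [hadd, e, hsingle]
    ring
  apply hne
  simp only [hpol]
  have i1 := hint (e i + e j + e l)
  have i2 := i1.sub (hint (e i + e j))
  have i3 := i2.sub (hint (e i + e l))
  have i4 := i3.sub (hint (e j + e l))
  have i5 := i4.add (hint (e i))
  have i6 := i5.add (hint (e j))
  have key := integral_add' i6 (hint (e l))
  rw [integral_add' i5 (hint _), integral_add' i4 (hint _), integral_sub' i3 (hint _),
    integral_sub' i2 (hint _), integral_sub' i1 (hint _)] at key
  rw [integral_const_mul]
  exact mul_eq_zero_of_right _ (key.trans (by simp only [hcon]; norm_num))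

end Moments

/-! ### From homogeneity to the Euler equation -/

section Homogeneity

variable {T : Type*} [MeasurableSpace T] {μ : Measure T} [IsProbabilityMeasure μ] {d : ℕ}
  {φ : Fin d → T → ℝ} {I : Set ℝ} {f f₁ f₂ f₃ g g₁ g₂ g₃ : ℝ → ℝ}

lemma wronskiQuot_continuousAt {fₙ gₙ : ℝ → ℝ} (hf : DerivChain I f f₁ f₂ f₃)
    (hg : DerivChain I g g₁ g₂ g₃) (hW : ∀ x ∈ I, f₁ x * g x - f x * g₁ x ≠ 0) {x : ℝ} (hx : x ∈ I)
    (hfₙ : ContinuousAt fₙ x) (hgₙ : ContinuousAt gₙ x) :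
    ContinuousAt (wronskiQuot f f₁ fₙ g g₁ gₙ) x := by
  have c1 := (hf.hasDerivAt_zero x hx).continuousAt
  have c2 := (hg.hasDerivAt_zero x hx).continuousAt
  have c3 := (hf.hasDerivAt_one x hx).continuousAt
  have c4 := (hg.hasDerivAt_one x hx).continuousAt
  exact ((hfₙ.mul c2).sub (c1.mul hgₙ)).div ((c3.mul c2).sub (c1.mul c4)) (hW x hx)

/-- The means along x₀ + s·a and along its c-multiple are y(s) and c·y(s), so `tendsto_moments`
applies at both base points with w and c·w, and `tendsto_scaling` compares them. -/
lemma wronskiQuot_scaling (h : IsChebyshevSystem I f g) (hI : I.OrdConnected) (hopen : IsOpen I)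
    (hpos : I ⊆ Ioi 0) (hf : DerivChain I f f₁ f₂ f₃) (hg : DerivChain I g g₁ g₂ g₃)
    (hW : ∀ x ∈ I, f₁ x * g x - f x * g₁ x ≠ 0)
    (hφmeas : ∀ i, AEMeasurable (φ i) μ)
    (hφ01 : ∀ i t, φ i t ∈ Icc (0 : ℝ) 1) (hφsum : ∀ t, ∑ i, φ i t = 1)
    (hthird : ∃ i j l, ∫ t, centred μ (φ i) t * centred μ (φ j) t * centred μ (φ l) t ∂μ ≠ 0)
    (hhom : IsHomogeneousOn I (bajMean I f g (weightedFamily φ) μ)) :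
    ∀ c : ℝ, 0 < c → ∀ x ∈ I, c * x ∈ I →
      wronskiQuot f f₁ f₂ g g₁ g₂ x = c * wronskiQuot f f₁ f₂ g g₁ g₂ (c * x) ∧
      wronskiQuot f f₁ f₃ g g₁ g₃ x = c ^ 2 * wronskiQuot f f₁ f₃ g g₁ g₃ (c * x) := by
  have hφint : ∀ i, Integrable (φ i) μ := fun i =>
    Integrable.of_bound (hφmeas i).aestronglyMeasurable 1 (Eventually.of_forall fun t => by
      rw [Real.norm_eq_abs, abs_le]
      constructor <;> linarith [(hφ01 i t).1, (hφ01 i t).2])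
  have hcmeas : ∀ i, AEMeasurable (centred μ (φ i)) μ := fun i => (hφmeas i).sub_const _
  have hcb : ∀ i t, |centred μ (φ i) t| ≤ 1 := fun i t => by
    have i1 : 0 ≤ ∫ s, φ i s ∂μ := integral_nonneg fun s => (hφ01 i s).1
    have i2 : ∫ s, φ i s ∂μ ≤ 1 := by
      have := integral_mono (hφint i) (integrable_const (1 : ℝ)) fun s => (hφ01 i s).2
      simpa using this
    rw [centred, abs_le]
    constructor <;> linarith [(hφ01 i t).1, (hφ01 i t).2]
  obtain ⟨a, ha⟩ := exists_cubic_ne_zero hcmeas hcb hthird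
  set Z : T → ℝ := fun t => ∑ i, a i * centred μ (φ i) t with hZ
  set η : ℝ := ∑ i, a i * ∫ s, φ i s ∂μ with hη
  set K : ℝ := ∑ i, |a i| with hKdef
  have hZmeas : AEMeasurable Z μ :=
    Finset.aemeasurable_fun_sum _ fun i _ => (hcmeas i).const_mul _
  have hfam : ∀ t, weightedFamily φ a t = η + Z t := fun t => by
    simp only [weightedFamily, hη, hZ, centred, ← Finset.sum_add_distrib]
    exact Finset.sum_congr rfl fun i _ => by ring
  have haK : ∀ i, a i ∈ Icc (-K) K := fun i => by
    have : |a i| ≤ K := Finset.single_le_sum (f := fun i => |a i|) (fun i _ => abs_nonneg _)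
      (Finset.mem_univ i)
    exact abs_le.1 this
  have hK : ∀ t, |η + Z t| ≤ K := fun t => by
    rw [← hfam, abs_le]; exact weightedFamily_mem_Icc hφ01 hφsum haK t
  have hmean : ∫ t, Z t ∂μ = 0 := by
    rw [hZ, integral_finsetSum]
    · refine Finset.sum_eq_zero fun i _ => ?_
      rw [integral_const_mul]
      simp only [centred]
      rw [integral_sub (hφint i) (integrable_const _)]
      simp
    · exact fun i _ => ((hφint i).sub (integrable_const _)).const_mul _
  have hZb : ∀ t, |Z t| ≤ K + |η| := fun t => by
    have := abs_sub (η + Z t) η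
    rw [add_sub_cancel_left] at this
    linarith [hK t]
  -- A vanishing second moment would make Z zero almost everywhere, and the third moment with it.
  have hσ : ∫ t, Z t ^ 2 ∂μ ≠ 0 := fun h0 => by
    have := (integral_eq_zero_iff_of_nonneg (fun t => sq_nonneg (Z t))
      (integrable_pow_of_bound hZmeas hZb 2)).1 h0
    apply ha
    refine integral_eq_zero_of_ae ?_
    filter_upwards [this] with t ht
    have : Z t = 0 := by simpa using ht
    simp only [Pi.zero_apply]
    rw [show ∑ i, a i * centred μ (φ i) t = 0 from this]
    norm_num
  set Φ := wronskiQuot f f₁ f₂ g g₁ g₂ with hΦdef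
  set Θ := wronskiQuot f f₁ f₃ g g₁ g₃ with hΘdef
  have hΦc : ∀ x ∈ I, ContinuousAt Φ x := fun x hx => wronskiQuot_continuousAt hf hg hW hx
    (hf.hasDerivAt_two x hx).continuousAt (hg.hasDerivAt_two x hx).continuousAt
  have hΘc : ∀ x ∈ I, ContinuousAt Θ x := fun x hx => wronskiQuot_continuousAt hf hg hW hx
    (hf.continuousOn_three.continuousAt (hopen.mem_nhds hx))
    (hg.continuousOn_three.continuousAt (hopen.mem_nhds hx))
  -- The claim for Θ is conditional: it needs the relation for Φ at the points y(s), not only at x₀.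
  have main : ∀ c : ℝ, 0 < c → ∀ x ∈ I, c * x ∈ I → Φ x = c * Φ (c * x) ∧
      ((∀ z ∈ I, c * z ∈ I → Φ z = c * Φ (c * z)) → Θ x = c ^ 2 * Θ (c * x)) := by
    intro c hc x₀ hx₀ hcx₀
    set y : ℝ → ℝ := fun s => bajMean I f g (weightedFamily φ) μ (fun i => x₀ + s * a i) with hy
    set w : ℝ → ℝ := fun s => (y s - x₀) / s - η with hw
    have hs : ∀ k : ℝ, Tendsto (fun s : ℝ => x₀ + s * k) (𝓝[>] 0) (𝓝 x₀) := fun k => by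
      simpa using (tendsto_const_nhds (x := x₀)).add ((tendsto_nhdsWithin_of_tendsto_nhds
        (s := Ioi (0 : ℝ)) (a := (0 : ℝ)) tendsto_id).mul_const k)
    have hnear : ∀ᶠ z in 𝓝 x₀, z ∈ I ∧ c * z ∈ I :=
      (hopen.eventually_mem hx₀).and
        ((continuous_const_mul c).continuousAt.eventually (hopen.eventually_mem hcx₀))
    have hev : ∀ᶠ s : ℝ in 𝓝[>] 0, |y s - x₀| ≤ K * s ∧
        ∫ t, chebDet f g (x₀ + s * (η + Z t)) (y s) ∂μ = 0 ∧
        ∫ t, chebDet f g (c * x₀ + s * (c * η + c * Z t)) (c * y s) ∂μ = 0 ∧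
        y s ∈ I ∧ c * y s ∈ I := by
      filter_upwards [(hs K).eventually hnear, (hs (-K)).eventually hnear,
        eventually_mem_nhdsWithin] with s hhi hlo hs0
      have hs0 : 0 < s := hs0
      have hx : ∀ i, x₀ + s * a i ∈ Icc (x₀ + s * (-K)) (x₀ + s * K) := fun i =>
        ⟨by gcongr; exact (haK i).1, by gcongr; exact (haK i).2⟩
      have hcx : ∀ i, (c • fun i => x₀ + s * a i) i ∈
          Icc (c * (x₀ + s * (-K))) (c * (x₀ + s * K)) := fun i =>
        ⟨mul_le_mul_of_nonneg_left (hx i).1 hc.le, mul_le_mul_of_nonneg_left (hx i).2 hc.le⟩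
      obtain ⟨h1, h2⟩ := bajMean_spec h hI hopen hφmeas hφ01 hφsum hlo.1 hhi.1 hx
      obtain ⟨h3, h4⟩ := bajMean_spec h hI hopen hφmeas hφ01 hφsum hlo.2 hhi.2 hcx
      have hcI : c ∈ I / I := ⟨c * x₀, hcx₀, x₀, hx₀, by
        have : x₀ ≠ 0 := (show 0 < x₀ from hpos hx₀).ne'
        field_simp⟩
      have hyc := hhom c hcI (fun i => x₀ + s * a i) fun i =>
        ⟨hI.out hlo.1 hhi.1 (hx i), hI.out hlo.2 hhi.2 (hcx i)⟩
      rw [hyc] at h3 h4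
      have hm : ∀ t, weightedFamily φ (fun i => x₀ + s * a i) t = x₀ + s * (η + Z t) := fun t => by
        rw [← hfam]
        simp only [weightedFamily, mul_add, Finset.sum_add_distrib, ← Finset.sum_mul, hφsum,
          one_mul, Finset.mul_sum]
        congr 1
        exact Finset.sum_congr rfl fun i _ => by ring
      have hmc : ∀ t, weightedFamily φ (c • fun i => x₀ + s * a i) t =
          c * x₀ + s * (c * η + c * Z t) := fun t => by
        have : weightedFamily φ (c • fun i => x₀ + s * a i) t =
            c * weightedFamily φ (fun i => x₀ + s * a i) t := by
          simp only [weightedFamily, Pi.smul_apply, smul_eq_mul, Finset.mul_sum]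
          exact Finset.sum_congr rfl fun i _ => by ring
        rw [this, hm]; ring
      simp only [hm] at h2
      simp only [hmc] at h4
      refine ⟨?_, h2, h4, hI.out hlo.1 hhi.1 h1, hI.out hlo.2 hhi.2 h3⟩
      rw [abs_le]
      constructor <;> linarith [h1.1, h1.2]
    have hpos' : ∀ᶠ s : ℝ in 𝓝[>] 0, 0 < s := eventually_mem_nhdsWithin
    have hytend : Tendsto y (𝓝[>] 0) (𝓝 x₀) := by
      refine tendsto_of_tendsto_of_tendsto_of_le_of_le' (hs (-K)) (hs K) ?_ ?_
      · filter_upwards [hev] with s hs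
        linarith [(abs_le.1 hs.1).1]
      · filter_upwards [hev] with s hs
        linarith [(abs_le.1 hs.1).2]
    have hcytend : Tendsto (fun s => c * y s) (𝓝[>] 0) (𝓝 (c * x₀)) := hytend.const_mul c
    have hwb : ∀ᶠ s in 𝓝[>] 0, |w s| ≤ K + |η| := by
      filter_upwards [hev, hpos'] with s hs hs0
      have h1 : |(y s - x₀) / s| ≤ K := by
        rw [abs_div, abs_of_pos hs0, div_le_iff₀ hs0]; exact hs.1
      exact (abs_sub _ _).trans (by linarith)
    have t0 := tendsto_moments hopen hf hg hW hx₀ hZmeas hK hmean rfl rfl (y := y) (w := w)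
      (fun s => rfl) (hev.mono fun s hs => ⟨hs.1, hs.2.1⟩)
    have t1 := tendsto_moments (μ := μ) hopen hf hg hW hcx₀ (Z := fun t => c * Z t) (η := c * η)
      (K := c * K) (σ := c ^ 2 * ∫ t, Z t ^ 2 ∂μ) (τ := c ^ 3 * ∫ t, Z t ^ 3 ∂μ)
      (y := fun s => c * y s) (w := fun s => c * w s) (hZmeas.const_mul c)
      (fun t => by
        rw [← mul_add, abs_mul, abs_of_pos hc]
        exact mul_le_mul_of_nonneg_left (hK t) hc.le)
      (by rw [integral_const_mul, hmean, mul_zero])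
      (by simp only [mul_pow]; rw [integral_const_mul])
      (by simp only [mul_pow]; rw [integral_const_mul])
      (fun s => by simp only [hw]; ring)
      (hev.mono fun s hs => ⟨by
        rw [← mul_sub, abs_mul, abs_of_pos hc, mul_assoc]
        exact mul_le_mul_of_nonneg_left hs.1 hc.le, hs.2.2.1⟩)
    obtain ⟨r1, r2⟩ := tendsto_scaling ((hΦc x₀ hx₀).tendsto.comp hytend)
      ((hΦc _ hcx₀).tendsto.comp hcytend) ((hΘc x₀ hx₀).tendsto.comp hytend)
      ((hΘc _ hcx₀).tendsto.comp hcytend) hwb hσ ha hc.ne' t0 t1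
    exact ⟨r1, fun hall => r2 (hev.mono fun s hs => hall _ hs.2.2.2.1 hs.2.2.2.2)⟩
  intro c hc x hx hcx
  exact ⟨(main c hc x hx hcx).1, (main c hc x hx hcx).2 fun z hz hcz => (main c hc z hz hcz).1⟩

/-- Scaling of the Wronskian quotients forces both generators to solve one Euler equation. -/
lemma exists_solvesEuler_of_scaling (hne : I.Nonempty) (hopen : IsOpen I) (hpos : I ⊆ Ioi 0)
    (hf : DerivChain I f f₁ f₂ f₃) (hg : DerivChain I g g₁ g₂ g₃)
    (hW : ∀ x ∈ I, f₁ x * g x - f x * g₁ x ≠ 0)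
    (hscale : ∀ c : ℝ, 0 < c → ∀ x ∈ I, c * x ∈ I →
      wronskiQuot f f₁ f₂ g g₁ g₂ x = c * wronskiQuot f f₁ f₂ g g₁ g₂ (c * x) ∧
      wronskiQuot f f₁ f₃ g g₁ g₃ x = c ^ 2 * wronskiQuot f f₁ f₃ g g₁ g₃ (c * x)) :
    ∃ α β : ℝ, SolvesEuler α β I f f₁ ∧ SolvesEuler α β I g g₁ := by
  obtain ⟨x₁, hx₁⟩ := hne
  have hx₁0 : 0 < x₁ := hpos hx₁
  set α := x₁ * wronskiQuot f f₁ f₂ g g₁ g₂ x₁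
  set γ := x₁ ^ 2 * wronskiQuot f f₁ f₃ g g₁ g₃ x₁
  have h20 : ∀ x ∈ I, f₂ x * g x - f x * g₂ x = α / x * (f₁ x * g x - f x * g₁ x) := by
    intro x hx
    have hx0 : 0 < x := hpos hx
    have hxx : x / x₁ * x₁ = x := div_mul_cancel₀ _ hx₁0.ne'
    -- Any x in I is reached from the fixed point x₁ by the factor x / x₁.
    have := (hscale (x / x₁) (div_pos hx0 hx₁0) x₁ hx₁ (by rwa [hxx])).1
    rw [hxx] at this
    have hα : α = x * wronskiQuot f f₁ f₂ g g₁ g₂ x := by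
      simp only [α]; rw [this]; field_simp
    rw [hα, mul_div_cancel_left₀ _ hx0.ne', wronskiQuot, div_mul_cancel₀ _ (hW x hx)]
  have h30 : ∀ x ∈ I, f₃ x * g x - f x * g₃ x = γ / x ^ 2 * (f₁ x * g x - f x * g₁ x) := by
    intro x hx
    have hx0 : 0 < x := hpos hx
    have hxx : x / x₁ * x₁ = x := div_mul_cancel₀ _ hx₁0.ne'
    have := (hscale (x / x₁) (div_pos hx0 hx₁0) x₁ hx₁ (by rwa [hxx])).2
    rw [hxx] at this
    have hγ : γ = x ^ 2 * wronskiQuot f f₁ f₃ g g₁ g₃ x := by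
      simp only [γ]; rw [this]; field_simp
    rw [hγ, mul_div_cancel_left₀ _ (pow_pos hx0 2).ne', wronskiQuot, div_mul_cancel₀ _ (hW x hx)]
  -- Differentiating the relation `h20` produces f₃g - fg₃, known from `h30`, plus exactly this
  -- remaining Wronskian.
  have h21 : ∀ x ∈ I, f₂ x * g₁ x - f₁ x * g₂ x =
      -((γ + α - α ^ 2) / x ^ 2) * (f₁ x * g x - f x * g₁ x) := by
    intro x hx
    have hx0 : x ≠ 0 := (show 0 < x from hpos hx).ne'
    have d20 := ((hf.hasDerivAt_two x hx).mul (hg.hasDerivAt_zero x hx)).sub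
      ((hf.hasDerivAt_zero x hx).mul (hg.hasDerivAt_two x hx))
    have d10 := ((hf.hasDerivAt_one x hx).mul (hg.hasDerivAt_zero x hx)).sub
      ((hf.hasDerivAt_zero x hx).mul (hg.hasDerivAt_one x hx))
    have dα := ((hasDerivAt_const x α).div (hasDerivAt_id x) hx0).mul d10
    have := d20.unique (dα.congr_of_eventuallyEq (by
      filter_upwards [hopen.mem_nhds hx] with z hz
      simpa using h20 z hz))
    have e2 := h20 x hx
    have e3 := h30 x hx
    simp only [Pi.div_apply, Pi.sub_apply, Pi.mul_apply, id] at this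
    have e4 : f₂ x * g₁ x - f₁ x * g₂ x = (0 * x - α * 1) / x ^ 2 * (f₁ x * g x - f x * g₁ x) +
        α / x * (α / x * (f₁ x * g x - f x * g₁ x)) - γ / x ^ 2 * (f₁ x * g x - f x * g₁ x) := by
      linear_combination this - e3 + α / x * e2
    rw [e4]
    field_simp
    ring
  refine ⟨α, γ + α - α ^ 2, fun x hx => ⟨hf.hasDerivAt_zero x hx, ?_⟩,
    fun x hx => ⟨hg.hasDerivAt_zero x hx, ?_⟩⟩
  -- The identity f₂(f₁g - fg₁) = f₁(f₂g - fg₂) - f(f₂g₁ - f₁g₂) recovers f₂ from the Wronskians.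
  · convert hf.hasDerivAt_one x hx using 1
    refine mul_right_cancel₀ (hW x hx) ?_
    linear_combination f x * h21 x hx - f₁ x * h20 x hx
  · convert hg.hasDerivAt_one x hx using 1
    refine mul_right_cancel₀ (hW x hx) ?_
    linear_combination g x * h21 x hx - g₁ x * h20 x hx

end Homogeneity

end IntegralMeans

theorem mainTheorem10 {T : Type*} [MeasurableSpace T] (μ : Measure T) [IsProbabilityMeasure μ]
    (I : Set ℝ) (hIne : I.Nonempty) (hIopen : IsOpen I) (hIint : I.OrdConnected)
    (hIpos : I ⊆ Set.Ioi 0)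
    (f g : ℝ → ℝ) (hfg : IntegralMeans.ClassC 3 I f g)
    (d : ℕ) (φ : Fin d → T → ℝ) (hφmeas : ∀ i, AEMeasurable (φ i) μ)
    (hφ01 : ∀ i t, φ i t ∈ Set.Icc (0 : ℝ) 1) (hφsum : ∀ t, ∑ i, φ i t = 1)
    (hnondeg : μ {t | ∀ i, IntegralMeans.centred μ (φ i) t = 0} < 1)
    (hthird : ∃ i j l, ∫ t, IntegralMeans.centred μ (φ i) t * IntegralMeans.centred μ (φ j) t *
      IntegralMeans.centred μ (φ l) t ∂μ ≠ 0) :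
    IntegralMeans.IsHomogeneousOn I
        (IntegralMeans.bajMean I f g (IntegralMeans.weightedFamily φ) μ) ↔
      ∃ p q : ℂ, (p + q).im = 0 ∧ (p * q).im = 0 ∧
        IntegralMeans.IsChebyshevSystem I (IntegralMeans.giniFst p q)
          (IntegralMeans.giniSnd p q) ∧
        ∀ x : Fin d → ℝ, (∀ i, x i ∈ I) →
          IntegralMeans.bajMean I f g (IntegralMeans.weightedFamily φ) μ x =
            IntegralMeans.giniMean I p q (IntegralMeans.weightedFamily φ) μ x := by
  open IntegralMeans in
  constructor
  · intro hhom
    have hf := ContDiffOn.derivChain hIopen hfg.contDiffOn_fst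
    have hg := ContDiffOn.derivChain hIopen hfg.contDiffOn_snd
    have hW : ∀ x ∈ I, deriv f x * g x - f x * deriv g x ≠ 0 := fun x hx => by
      simpa [Matrix.det_fin_two] using hfg.wronskian_ne_zero (by norm_num) x hx
    obtain ⟨α, β, hfE, hgE⟩ := exists_solvesEuler_of_scaling hIne hIopen hIpos hf hg hW
      (wronskiQuot_scaling hfg.chebyshev hIint hIopen hIpos hf hg hW hφmeas hφ01 hφsum hthird hhom)
    obtain ⟨p, q, hs, hp, h₁, k₁, hhE, hkE, hhk⟩ := exists_gini_solvesEuler α β hIpos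
    obtain ⟨κ, hκ⟩ := SolvesEuler.chebDet_eq_const_mul hIint hIopen hfE hgE hhE hkE hhk
    -- A zero of the Gini determinant off the diagonal would be a zero of the proportional
    -- determinant of f and g.
    have hcheb : IsChebyshevSystem I (giniFst p q) (giniSnd p q) :=
      ⟨fun x hx => (hhE x hx).1.continuousAt.continuousWithinAt,
        fun x hx => (hkE x hx).1.continuousAt.continuousWithinAt,
        fun x hx y hy hxy h0 => hfg.chebyshev.det_ne_zero x hx y hy hxy (by
          rw [hκ x hx y hy, h0, mul_zero])⟩
    refine ⟨p, q, hs, hp, hcheb, fun x hx => ?_⟩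
    obtain ⟨i, j, hij⟩ := exists_bounds μ hφsum x
    have hsub := hIint.out (hx i) (hx j)
    obtain ⟨h1, h2⟩ := bajMean_spec hcheb hIint hIopen hφmeas hφ01 hφsum (hx i) (hx j) hij
    refine eq_bajMean_of_root hfg.chebyshev hIint hIopen hφmeas hφ01 hφsum hx (hsub h1) ?_
    have : ∀ t, chebDet f g (weightedFamily φ x t) (giniMean I p q (weightedFamily φ) μ x) =
        κ * chebDet (giniFst p q) (giniSnd p q) (weightedFamily φ x t)
          (giniMean I p q (weightedFamily φ) μ x) := fun t =>
      hκ _ (hsub (weightedFamily_mem_Icc hφ01 hφsum hij t)) _ (hsub h1)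
    simp only [this]
    rw [integral_const_mul]
    exact mul_eq_zero_of_right _ h2
  · rintro ⟨p, q, -, -, hcheb, heq⟩ c hc x hx
    rw [heq x fun i => (hx i).1, heq (c • x) fun i => (hx i).2]
    exact isHomogeneousOn_giniMean p q hIint hIopen hIpos hcheb hφmeas hφ01 hφsum c hc x hx
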